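/- All systems are finite-dimensional and $\log=\log_2$. Let $\rho_{C_AA}$ and $\tilde\rho_{C_BB}$ be density operators that are PPT, i.e. whose partial transposes $\rho^\Gamma$, $\tilde\rho^\Gamma$ with respect to the systems $C_A$, $C_B$ are positive semidefinite. Then $$K_{A\leftrightarrow C\leftrightarrow B}(\rho\otimes\tilde\rho)\;\le\;E_R^\infty(\rho^\Gamma)+E_R^\infty(\tilde\rho^\Gamma),$$ where the limits defining the right-hand side exist. The quantities are defined as follows. The regularised relative entropy of entanglement is $E_R^\infty(\rho)=\lim_{n\to\infty}\frac1n E_R(\rho^{\otimes n})$, where $\rho^{\otimes n}$ is regarded as a bipartite state in the cut $C^n:A^n$ and $E_R(\rho)=\inf_{\sigma}D(\rho\|\sigma)$ with the infimum over separable states $\sigma$ (convex combinations of product states). Here $D(\rho\|\sigma)=\operatorname{tr}\rho(\log\rho-\log\sigma)$ if the support of $\rho$ is contained in the support of $\sigma$, and $+\infty$ otherwise. The quantum key repeater rate is $$K_{A\leftrightarrow C\leftrightarrow B}(\rho\otimes\tilde\rho)=\inf_{\epsilon>0}\limsup_{n\to\infty}\sup_{\Lambda_n,\gamma_m}\Big\{\tfrac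 mn:\ \big\|\operatorname{tr}_C\Lambda_n\big((\rho_{C_AA}\otimes\tilde\rho_{C_BB})^{\otimes n}\big)-\gamma_m\big\|_1\le\epsilon\Big\},$$ where $\Lambda_n$ ranges over the channels implemented by three-party LOCC protocols (finitely many rounds of local quantum instruments whose outcomes are communicated to all parties) among Alice, holding $A^n$, Charlie, holding $(C_AC_B)^n$, and Bob, holding $B^n$, and $\operatorname{tr}_C$ discards Charlie's output system. Further, $m\in\{0,1,2,\dots\}$, and $\gamma_m$ ranges over the private states with $m$ key bits, that is the states $$\gamma_m=U\big(|\Psi\rangle\langle\Psi|\otimes\sigma\big)U^\dagger,\qquad |\Psi\rangle=2^{-m/2}\sum_{i=0}^{2^m-1}|ii\rangle,\qquad U=\sum_{i,j}|ij\rangle\langle ij|\otimes U^{(ij)},$$ on Alice's system (key, shield) and Bob's system (key, shield), with $|\Psi\rangle$ on the two key systems, $\sigma$ an arbitrary state of the two shield systems (of arbitrary finite dimensions), and arbitrary unitaries $U^{(ij)}$ on the shield. -/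

import Mathlib

open Filter Topology
open scoped Matrix Kronecker ComplexOrder

noncomputable section

namespace KeyRepeater

/-! Finite-dimensional quantum systems are identified with finite types labelling an orthonormal
basis; operators are complex matrices. -/

/-- Density operators: positive semidefinite operators of trace one. -/
def IsState {ι : Type} [Fintype ι] (ρ : Matrix ι ι ℂ) : Prop :=
  ρ.PosSemidef ∧ ρ.trace = 1

/-- The trace norm `‖X‖₁ = tr √(X† X)`, i.e. the sum of the singular values. -/
def traceNorm {ι : Type} [Fintype ι] [DecidableEq ι] (X : Matrix ι ι ℂ) : ℝ :=
  ∑ i, √((Matrix.isHermitian_conjTranspose_mul_self X).eigenvalues i)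

/-- The partial transpose `X^Γ` with respect to the first tensor factor. -/
def partialTranspose {c a : Type} (X : Matrix (c × a) (c × a) ℂ) : Matrix (c × a) (c × a) ℂ :=
  Matrix.of fun x y => X (y.1, x.2) (x.1, y.2)

/-- The `n`-fold tensor power `X^{⊗ n}`. -/
def tensorPower {ι : Type} (X : Matrix ι ι ℂ) (n : ℕ) : Matrix (Fin n → ι) (Fin n → ι) ℂ :=
  Matrix.of fun x y => ∏ i, X (x i) (y i)

/-! ### Relative entropy of entanglement -/

/-- The separable states of the bipartition `c : a`: convex combinations of product states. -/
def separableStates (c a : Type) [Fintype c] [Fintype a] : Set (Matrix (c × a) (c × a) ℂ) :=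
  convexHull ℝ {σ | ∃ (α : Matrix c c ℂ) (β : Matrix a a ℂ), IsState α ∧ IsState β ∧ σ = α ⊗ₖ β}

open Classical in
/-- The quantum relative entropy `D(ρ‖σ) = tr ρ (log₂ ρ - log₂ σ)` of two states, which is `+∞`
unless the support of `ρ` is contained in that of `σ` (equivalently `ker σ ⊆ ker ρ`).  The
logarithms are taken by functional calculus, with value `0` on the kernel. -/
def relativeEntropy {ι : Type} [Fintype ι] [DecidableEq ι] (ρ σ : Matrix ι ι ℂ) : EReal :=
  if ∀ v : ι → ℂ, σ *ᵥ v = 0 → ρ *ᵥ v = 0 then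
    (((ρ * (cfc (Real.logb 2) ρ - cfc (Real.logb 2) σ)).trace.re : ℝ) : EReal)
  else ⊤

/-- The relative entropy of entanglement `E_R(ρ) = inf_{σ ∈ SEP} D(ρ‖σ)`. -/
def relEntEntanglement {c a : Type} [Fintype c] [DecidableEq c] [Fintype a] [DecidableEq a]
    (ρ : Matrix (c × a) (c × a) ℂ) : EReal :=
  ⨅ σ ∈ separableStates c a, relativeEntropy ρ σ

/-- `ρ^{⊗ n}` as a bipartite operator, in the cut `cⁿ : aⁿ`. -/
def bipartitePower {c a : Type} (ρ : Matrix (c × a) (c × a) ℂ) (n : ℕ) :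
    Matrix ((Fin n → c) × (Fin n → a)) ((Fin n → c) × (Fin n → a)) ℂ :=
  (tensorPower ρ n).submatrix (fun x i => (x.1 i, x.2 i)) (fun x i => (x.1 i, x.2 i))

/-- The sequence `E_R(ρ^{⊗ n}) / n`. -/
def relEntRate {c a : Type} [Fintype c] [DecidableEq c] [Fintype a] [DecidableEq a]
    (ρ : Matrix (c × a) (c × a) ℂ) (n : ℕ) : EReal :=
  relEntEntanglement (bipartitePower ρ n) / (n : EReal)

/-- The regularised relative entropy of entanglement `E_R^∞(ρ) = lim_n E_R(ρ^{⊗ n}) / n`, written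
as a limit superior so that it makes sense before the limit is known to exist. -/
def regRelEntEntanglement {c a : Type} [Fintype c] [DecidableEq c] [Fintype a] [DecidableEq a]
    (ρ : Matrix (c × a) (c × a) ℂ) : EReal :=
  limsup (relEntRate ρ) atTop

/-! ### LOCC protocols between Alice, Charlie and Bob -/

/-- The operation `X ↦ (L ⊗ 1 ⊗ 1) X (L ⊗ 1 ⊗ 1)†` on Alice's system. -/
def actAlice {a c b a₁ : Type} [Fintype a] [Fintype c] [Fintype b] [DecidableEq c] [DecidableEq b]
    (L : Matrix a₁ a ℂ) (X : Matrix (a × c × b) (a × c × b) ℂ) :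
    Matrix (a₁ × c × b) (a₁ × c × b) ℂ :=
  (L ⊗ₖ ((1 : Matrix c c ℂ) ⊗ₖ (1 : Matrix b b ℂ))) * X *
    (L ⊗ₖ ((1 : Matrix c c ℂ) ⊗ₖ (1 : Matrix b b ℂ)))ᴴ

/-- The operation `X ↦ (1 ⊗ L ⊗ 1) X (1 ⊗ L ⊗ 1)†` on Charlie's system. -/
def actCharlie {a c b c₁ : Type} [Fintype a] [Fintype c] [Fintype b] [DecidableEq a]
    [DecidableEq b] (L : Matrix c₁ c ℂ) (X : Matrix (a × c × b) (a × c × b) ℂ) :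
    Matrix (a × c₁ × b) (a × c₁ × b) ℂ :=
  ((1 : Matrix a a ℂ) ⊗ₖ (L ⊗ₖ (1 : Matrix b b ℂ))) * X *
    ((1 : Matrix a a ℂ) ⊗ₖ (L ⊗ₖ (1 : Matrix b b ℂ)))ᴴ

/-- The operation `X ↦ (1 ⊗ 1 ⊗ L) X (1 ⊗ 1 ⊗ L)†` on Bob's system. -/
def actBob {a c b b₁ : Type} [Fintype a] [Fintype c] [Fintype b] [DecidableEq a] [DecidableEq c]
    (L : Matrix b₁ b ℂ) (X : Matrix (a × c × b) (a × c × b) ℂ) :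
    Matrix (a × c × b₁) (a × c × b₁) ℂ :=
  ((1 : Matrix a a ℂ) ⊗ₖ ((1 : Matrix c c ℂ) ⊗ₖ L)) * X *
    ((1 : Matrix a a ℂ) ⊗ₖ ((1 : Matrix c c ℂ) ⊗ₖ L))ᴴ

/-- A quantum instrument given by Kraus operators `K i j` from `x` to `y`: the outcome `i` is
observed, the index `j` is discarded, and the sum of the associated completely positive maps over
all outcomes preserves the trace. -/
def IsInstrument {x y : Type} [Fintype y] [DecidableEq x] {r s : ℕ}
    (K : Fin r → Fin s → Matrix y x ℂ) : Prop :=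
  ∑ i, ∑ j, (K i j)ᴴ * K i j = 1

/-- The channels implemented by LOCC protocols with finitely many rounds among Alice (`a`),
Charlie (`c`) and Bob (`b`), with output systems `a' , c' , b'`.  In each round one of the parties
applies an instrument to his or her system (whose dimension may change) and announces the outcome
`i` to everybody; the remainder of the protocol may depend on `i`. -/
inductive IsLOCC {a' c' b' : Type} : ∀ {a c b : Type},
    (Matrix (a × c × b) (a × c × b) ℂ → Matrix (a' × c' × b') (a' × c' × b') ℂ) → Prop
  | done : IsLOCC (fun X : Matrix (a' × c' × b') (a' × c' × b') ℂ => X)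
  | alice {a c b a₁ : Type} [Fintype a] [Fintype c] [Fintype b] [Fintype a₁]
      [DecidableEq a] [DecidableEq c] [DecidableEq b] {r s : ℕ}
      (K : Fin r → Fin s → Matrix a₁ a ℂ) (hK : IsInstrument K)
      (Λ : Fin r → Matrix (a₁ × c × b) (a₁ × c × b) ℂ → Matrix (a' × c' × b') (a' × c' × b') ℂ)
      (hΛ : ∀ i, IsLOCC (Λ i)) :
      IsLOCC (fun X : Matrix (a × c × b) (a × c × b) ℂ => ∑ i, Λ i (∑ j, actAlice (K i j) X))
  | charlie {a c b c₁ : Type} [Fintype a] [Fintype c] [Fintype b] [Fintype c₁]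
      [DecidableEq a] [DecidableEq c] [DecidableEq b] {r s : ℕ}
      (K : Fin r → Fin s → Matrix c₁ c ℂ) (hK : IsInstrument K)
      (Λ : Fin r → Matrix (a × c₁ × b) (a × c₁ × b) ℂ → Matrix (a' × c' × b') (a' × c' × b') ℂ)
      (hΛ : ∀ i, IsLOCC (Λ i)) :
      IsLOCC (fun X : Matrix (a × c × b) (a × c × b) ℂ => ∑ i, Λ i (∑ j, actCharlie (K i j) X))
  | bob {a c b b₁ : Type} [Fintype a] [Fintype c] [Fintype b] [Fintype b₁]
      [DecidableEq a] [DecidableEq c] [DecidableEq b] {r s : ℕ}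
      (K : Fin r → Fin s → Matrix b₁ b ℂ) (hK : IsInstrument K)
      (Λ : Fin r → Matrix (a × c × b₁) (a × c × b₁) ℂ → Matrix (a' × c' × b') (a' × c' × b') ℂ)
      (hΛ : ∀ i, IsLOCC (Λ i)) :
      IsLOCC (fun X : Matrix (a × c × b) (a × c × b) ℂ => ∑ i, Λ i (∑ j, actBob (K i j) X))

/-- The partial trace over Charlie's system. -/
def traceCharlie {a c b : Type} [Fintype c] (X : Matrix (a × c × b) (a × c × b) ℂ) :
    Matrix (a × b) (a × b) ℂ :=
  Matrix.of fun x y => ∑ k, X (x.1, k, x.2) (y.1, k, y.2)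

/-! ### Private states and the key repeater rate -/

/-- The projector onto the maximally entangled state `k^{-1/2} ∑ᵢ |ii⟩`. -/
def maxEntangled (k : ℕ) : Matrix (Fin k × Fin k) (Fin k × Fin k) ℂ :=
  Matrix.of fun x y => if x.1 = x.2 ∧ y.1 = y.2 then (1 / k : ℂ) else 0

/-- The twisting operation `∑_{ij} |ij⟩⟨ij| ⊗ U^{(ij)}`, with control on the key part. -/
def twist {k p q : ℕ} (U : Fin k × Fin k → Matrix (Fin p × Fin q) (Fin p × Fin q) ℂ) :
    Matrix ((Fin k × Fin k) × (Fin p × Fin q)) ((Fin k × Fin k) × (Fin p × Fin q)) ℂ :=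
  Matrix.of fun x y => if x.1 = y.1 then U x.1 x.2 y.2 else 0

/-- `γ` is a private state `γ_m` with `m` key bits: a twisted maximally entangled state of rank
`2^m` on the key part, tensored with an arbitrary state on the shield part.  Alice holds the first
pair (key, shield) of the index, Bob the second. -/
def IsPrivateState (m : ℕ) {p q : ℕ} (γ : Matrix ((Fin (2 ^ m) × Fin p) × (Fin (2 ^ m) × Fin q))
    ((Fin (2 ^ m) × Fin p) × (Fin (2 ^ m) × Fin q)) ℂ) : Prop :=
  ∃ (U : Fin (2 ^ m) × Fin (2 ^ m) → Matrix (Fin p × Fin q) (Fin p × Fin q) ℂ)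
    (σ : Matrix (Fin p × Fin q) (Fin p × Fin q) ℂ),
    (∀ x, U x ∈ Matrix.unitaryGroup (Fin p × Fin q) ℂ) ∧ IsState σ ∧
    γ = (twist U * (maxEntangled (2 ^ m) ⊗ₖ σ) * (twist U)ᴴ).submatrix
      (Equiv.prodProdProdComm _ _ _ _) (Equiv.prodProdProdComm _ _ _ _)

/-- `(ρ ⊗ ρ')^{⊗ n}` as an operator of Alice (`Aⁿ`), Charlie (`(C_A C_B)ⁿ`) and Bob (`Bⁿ`). -/
def repeaterInput {A CA CB B : Type} (ρ : Matrix (CA × A) (CA × A) ℂ)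
    (ρ' : Matrix (CB × B) (CB × B) ℂ) (n : ℕ) :
    Matrix ((Fin n → A) × (Fin n → CA × CB) × (Fin n → B))
      ((Fin n → A) × (Fin n → CA × CB) × (Fin n → B)) ℂ :=
  (tensorPower (ρ ⊗ₖ ρ') n).submatrix
    (fun x i => (((x.2.1 i).1, x.1 i), ((x.2.1 i).2, x.2.2 i)))
    (fun x i => (((x.2.1 i).1, x.1 i), ((x.2.1 i).2, x.2.2 i)))

/-- From `n` copies of `ρ ⊗ ρ'` some LOCC protocol, followed by tracing out Charlie, produces a
state that is `ε`-close in trace norm to a private state with `m` key bits. -/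
def Achievable {A CA CB B : Type} (ρ : Matrix (CA × A) (CA × A) ℂ)
    (ρ' : Matrix (CB × B) (CB × B) ℂ) (ε : ℝ) (n m : ℕ) : Prop :=
  ∃ (p q t : ℕ)
    (Λ : Matrix ((Fin n → A) × (Fin n → CA × CB) × (Fin n → B))
        ((Fin n → A) × (Fin n → CA × CB) × (Fin n → B)) ℂ →
      Matrix ((Fin (2 ^ m) × Fin p) × Fin t × (Fin (2 ^ m) × Fin q))
        ((Fin (2 ^ m) × Fin p) × Fin t × (Fin (2 ^ m) × Fin q)) ℂ)
    (γ : Matrix ((Fin (2 ^ m) × Fin p) × (Fin (2 ^ m) × Fin q))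
      ((Fin (2 ^ m) × Fin p) × (Fin (2 ^ m) × Fin q)) ℂ),
    IsLOCC Λ ∧ IsPrivateState m γ ∧
      traceNorm (traceCharlie (Λ (repeaterInput ρ ρ' n)) - γ) ≤ ε

/-- The quantum key repeater rate `K_{A↔C↔B}(ρ ⊗ ρ')`:
`inf_{ε > 0} limsup_n sup {m / n : m key bits are ε-achievable from n copies}`. -/
def keyRepeaterRate {A CA CB B : Type} (ρ : Matrix (CA × A) (CA × A) ℂ)
    (ρ' : Matrix (CB × B) (CB × B) ℂ) : EReal :=
  ⨅ (ε : ℝ) (_ : 0 < ε),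
    limsup (fun n : ℕ => ⨆ (m : ℕ) (_ : Achievable ρ ρ' ε n m), (((m : ℝ) / (n : ℝ) : ℝ) : EReal))
      atTop

end KeyRepeater

end

set_option linter.unusedSectionVars false

namespace KeyRepeater

/-! The term of Bob's state alone already bounds the rate; the other term is nonnegative and is
added at the end. Write `Γ` for the partial transpose on Charlie's part.

Fix a protocol `Λ` on `n` copies whose output is `ε`-close to a private state, and let `P` be the
projector onto the corresponding twisted maximally entangled states. For `τ` on Charlie's and Bob's
systems put `φ(τ) = tr P tr_C Λ(ρ^{⊗n} ⊗ τ^Γ)`. The input `ρ^{⊗n} ⊗ τ^Γ` need not be positive, but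
transposing Charlie turns it into `(ρ^{⊗n})^Γ ⊗ τ`, which is positive when `τ` is. A local Kraus
operator of Charlie becomes its complex conjugate under this transposition, the other parties'
operators are unaffected, and the final trace over Charlie does not see it. Hence `φ` is positive
and bounded by the trace: `φ(τ) = tr τM` for an effect `0 ≤ M ≤ 1` (`exists_effect`).

At `τ = (ρ'^Γ)^{⊗n}` the true input is recovered, so `φ ≥ 1 - ε`. At a product state `τ` the input
is a product across the cut Alice and Charlie versus Bob, so Alice and Bob end with a separable
state, whose overlap with `P` is at most `2^{-m}` (`trace_keyProjector_mul_kronecker_le`). Thus `M`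
distinguishes `(ρ'^Γ)^{⊗n}` from every separable state, and `measured_le_relativeEntropy` gives
`E_R((ρ'^Γ)^{⊗n}) ≥ (1 - ε)m - 1/ln 2`. Dividing by `n`, then letting `n → ∞` and `ε → 0`, yields
the bound. The limits exist by Fekete's lemma, since `E_R` is subadditive on tensor powers.

The variational inequality `D(ρ‖σ) ≥ tr ρM log₂ n + tr σM (1 - n)/ln 2` is proved without
monotonicity of `D`: over pairs of eigenvectors, `D` is a sum of `l log(l/μ) - l + μ`, an average of
quotients `(l - μ)² / ((1 - s)μ + sl)`, and each quotient has quadratic lower bounds into which the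
matrix elements of `M` can be inserted. -/

/-! ### Scalar inequalities behind the variational bound -/

/-- Taylor's formula with integral remainder for `f(w) = w log w` on the segment from `μ` to `l`:
`f(w) + (1 - s)(l - μ)f'(w)` has derivative `(1 - s)(l - μ)² f''(w)`. Integrated over `[0, 1]` it
represents `l log(l/μ) - l + μ`. -/
lemma hasDerivAt_entropy_remainder (l μ s : ℝ) (hw : 0 < (1 - s) * μ + s * l) :
    HasDerivAt (fun s : ℝ => ((1 - s) * μ + s * l) * Real.log ((1 - s) * μ + s * l) +
        (1 - s) * (l - μ) * (Real.log ((1 - s) * μ + s * l) + 1))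
      ((1 - s) * ((l - μ) ^ 2 / ((1 - s) * μ + s * l))) s := by
  have h1 : HasDerivAt (fun s : ℝ => 1 - s) (-1) s := by
    simpa using (hasDerivAt_id s).const_sub 1
  have h2 : HasDerivAt (fun s : ℝ => (1 - s) * μ + s * l) (-1 * μ + 1 * l) s :=
    (h1.mul_const μ).add ((hasDerivAt_id s).mul_const l)
  have h3 := h2.log hw.ne'
  refine ((h2.mul h3).add ((h1.mul_const (l - μ)).mul (h3.add_const 1))).congr_deriv ?_
  obtain ⟨w, hw'⟩ : ∃ w, (1 - s) * μ + s * l = w := ⟨_, rfl⟩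
  rw [hw'] at hw
  simp only [hw']
  field_simp
  rw [← hw']
  ring

/-- The matrix with rows `(a, b)` and `(b, d)` is positive semidefinite; evaluate its quadratic form
at `(D, -xw)` and divide by `w`. For `a = b = d = 1` this is `D² / w ≥ 2xD - x²w`. -/
lemma quadratic_le {a b d D w x : ℝ} (ha : 0 ≤ a) (hd : 0 ≤ d) (hb : b ^ 2 ≤ a * d)
    (hw : 0 < w) : 2 * b * x * D - d * x ^ 2 * w ≤ a * (D ^ 2 / w) := by
  rw [← mul_div_assoc, le_div_iff₀ hw]
  have key : 0 ≤ a * D ^ 2 - 2 * b * D * (x * w) + d * (x * w) ^ 2 := by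
    rcases ha.eq_or_lt with rfl | ha
    · have : b = 0 := by nlinarith [sq_nonneg b]
      subst this
      nlinarith [mul_nonneg hd (sq_nonneg (x * w))]
    · have : 0 ≤ a * (a * D ^ 2 - 2 * b * D * (x * w) + d * (x * w) ^ 2) := by
        nlinarith [sq_nonneg (a * D - b * (x * w)), mul_nonneg (sub_nonneg.2 hb) (sq_nonneg (x * w))]
      exact nonneg_of_mul_nonneg_right this ha
  nlinarith

/-- Coefficients realising the tangent plane of `(l, μ) ↦ l log (l / μ) - l + μ` at `(n, 1)` as
averages, together with the induced family of quadratic lower bounds. -/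
lemma exists_entropy_tangent {n : ℝ} (hn : 1 ≤ n) :
    ∃ I₁ I₂ I₃ : ℝ, 0 ≤ I₂ ∧ 0 ≤ I₃ ∧ 2 * I₁ - I₃ = Real.log n ∧ 2 * I₁ + I₂ = n - 1 ∧
      ∀ a b d l μ : ℝ, 0 ≤ a → 0 ≤ d → b ^ 2 ≤ a * d → 0 ≤ l → 0 ≤ μ → (μ = 0 → a = 0 ∨ l = 0) →
        2 * b * (l - μ) * I₁ - d * (μ * I₂ + l * I₃) ≤
          a * (l * (Real.log l - Real.log μ) - l + μ) := by
  -- The optimal `x` in `quadratic_le` is `D / w`; its value at `(l, μ) = (n, 1)` makes the averaged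
  -- bound tangent there.
  set x : ℝ → ℝ := fun s => (n - 1) / ((1 - s) * 1 + s * n) with hx
  have hpos : ∀ s ∈ Set.Icc (0 : ℝ) 1, ∀ l μ : ℝ, 0 < l → 0 < μ → 0 < (1 - s) * μ + s * l := by
    intro s hs l μ hl hμ
    rcases hs.1.eq_or_lt with rfl | h
    · simpa using hμ
    · have := mul_nonneg (sub_nonneg.2 hs.2) hμ.le
      have := mul_pos h hl
      linarith
  have hn0 : 0 < n := by linarith
  have hxc : ContinuousOn x (Set.uIcc 0 1) := by
    rw [Set.uIcc_of_le zero_le_one]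
    refine ContinuousOn.div (by fun_prop) (by fun_prop) fun s hs => ?_
    exact (hpos s hs n 1 hn0 one_pos).ne'
  have c1 : ContinuousOn (fun s => (1 - s) * x s) (Set.uIcc 0 1) := by fun_prop
  have c2 : ContinuousOn (fun s => (1 - s) ^ 2 * x s ^ 2) (Set.uIcc 0 1) := by fun_prop
  have c3 : ContinuousOn (fun s => s * (1 - s) * x s ^ 2) (Set.uIcc 0 1) := by fun_prop
  have i1 := c1.intervalIntegrable (μ := MeasureTheory.volume)
  have i2 := c2.intervalIntegrable (μ := MeasureTheory.volume)
  have i3 := c3.intervalIntegrable (μ := MeasureTheory.volume)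
  refine ⟨∫ s in (0 : ℝ)..1, (1 - s) * x s, ∫ s in (0 : ℝ)..1, (1 - s) ^ 2 * x s ^ 2,
    ∫ s in (0 : ℝ)..1, s * (1 - s) * x s ^ 2, ?_, ?_, ?_, ?_, ?_⟩
  · exact intervalIntegral.integral_nonneg zero_le_one fun s hs => by positivity
  · refine intervalIntegral.integral_nonneg zero_le_one fun s hs => ?_
    have := sub_nonneg.2 hs.2
    have := hs.1
    positivity
  · rw [← intervalIntegral.integral_const_mul, ← intervalIntegral.integral_sub (i1.const_mul 2) i3]
    -- The combinations of `I₁, I₂, I₃` that are needed have elementary antiderivatives, here and in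
    -- the next case.
    have hd : ∀ s ∈ Set.uIcc (0 : ℝ) 1, HasDerivAt (fun s : ℝ =>
        Real.log ((1 - s) * 1 + s * n) + s * (1 - s) * ((n - 1) / ((1 - s) * 1 + s * n)))
        (2 * ((1 - s) * x s) - s * (1 - s) * x s ^ 2) s := by
      intro s hs
      rw [Set.uIcc_of_le zero_le_one] at hs
      have hw := hpos s hs n 1 hn0 one_pos
      have h1 : HasDerivAt (fun s : ℝ => 1 - s) (-1) s := by
        simpa using (hasDerivAt_id s).const_sub 1
      have h2 : HasDerivAt (fun s : ℝ => (1 - s) * 1 + s * n) (-1 * 1 + 1 * n) s :=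
        (h1.mul_const 1).add ((hasDerivAt_id s).mul_const n)
      have h3 := h2.log hw.ne'
      refine (h3.add (((hasDerivAt_id s).mul h1).mul
        ((hasDerivAt_const s (n - 1)).div h2 hw.ne'))).congr_deriv ?_
      have hw' : 1 - s + s * n ≠ 0 := by simpa using hw.ne'
      simp only [hx, id, Pi.mul_apply, Pi.div_apply, mul_one]
      field_simp
      ring
    rw [intervalIntegral.integral_eq_sub_of_hasDerivAt hd ((i1.const_mul 2).sub i3)]
    simp
  · rw [← intervalIntegral.integral_const_mul, ← intervalIntegral.integral_add (i1.const_mul 2) i2]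
    have hd : ∀ s ∈ Set.uIcc (0 : ℝ) 1, HasDerivAt (fun s : ℝ =>
        -((1 - s) ^ 2 * ((n - 1) / ((1 - s) * 1 + s * n))))
        (2 * ((1 - s) * x s) + (1 - s) ^ 2 * x s ^ 2) s := by
      intro s hs
      rw [Set.uIcc_of_le zero_le_one] at hs
      have hw := hpos s hs n 1 hn0 one_pos
      have h1 : HasDerivAt (fun s : ℝ => 1 - s) (-1) s := by
        simpa using (hasDerivAt_id s).const_sub 1
      have h2 : HasDerivAt (fun s : ℝ => (1 - s) * 1 + s * n) (-1 * 1 + 1 * n) s :=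
        (h1.mul_const 1).add ((hasDerivAt_id s).mul_const n)
      refine ((h1.pow 2).mul ((hasDerivAt_const s (n - 1)).div h2 hw.ne')).neg.congr_deriv ?_
      have hw' : 1 - s + s * n ≠ 0 := by simpa using hw.ne'
      simp only [hx, Pi.pow_apply, Pi.div_apply, mul_one]
      field_simp
      ring
    rw [intervalIntegral.integral_eq_sub_of_hasDerivAt hd ((i1.const_mul 2).add i2)]
    simp
  · intro a b d l μ ha hd hb hl hμ h0
    have hI2 : 0 ≤ ∫ s in (0 : ℝ)..1, (1 - s) ^ 2 * x s ^ 2 :=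
      intervalIntegral.integral_nonneg zero_le_one fun s hs => by positivity
    have hI3 : 0 ≤ ∫ s in (0 : ℝ)..1, s * (1 - s) * x s ^ 2 := by
      refine intervalIntegral.integral_nonneg zero_le_one fun s hs => ?_
      have := sub_nonneg.2 hs.2
      have := hs.1
      positivity
    have hlin : 2 * b * (l - μ) * (∫ s in (0 : ℝ)..1, (1 - s) * x s) -
        d * (μ * (∫ s in (0 : ℝ)..1, (1 - s) ^ 2 * x s ^ 2) +
          l * ∫ s in (0 : ℝ)..1, s * (1 - s) * x s ^ 2) =
        ∫ s in (0 : ℝ)..1, (2 * b * (l - μ) * ((1 - s) * x s) -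
          d * (μ * ((1 - s) ^ 2 * x s ^ 2) + l * (s * (1 - s) * x s ^ 2))) := by
      rw [intervalIntegral.integral_sub (i1.const_mul _)
        (((i2.const_mul μ).add (i3.const_mul l)).const_mul d),
        intervalIntegral.integral_const_mul, intervalIntegral.integral_const_mul,
        intervalIntegral.integral_add (i2.const_mul μ) (i3.const_mul l),
        intervalIntegral.integral_const_mul, intervalIntegral.integral_const_mul]
    have hii : IntervalIntegrable (fun s => 2 * b * (l - μ) * ((1 - s) * x s) -
          d * (μ * ((1 - s) ^ 2 * x s ^ 2) + l * (s * (1 - s) * x s ^ 2)))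
          MeasureTheory.volume 0 1 :=
      (i1.const_mul _).sub (((i2.const_mul μ).add (i3.const_mul l)).const_mul d)
    -- The integral representation needs `l` and `μ` positive, so the boundary cases are separate.
    -- If `μ = 0`, either the weight `a`, hence also `b`, vanishes, or `l = 0`.
    rcases hμ.eq_or_lt with rfl | hμ
    · rcases h0 rfl with rfl | rfl
      · have hb0 : b = 0 := by nlinarith [sq_nonneg b]
        subst hb0
        have := mul_nonneg hd (mul_nonneg hl hI3)
        simp only [mul_zero, zero_mul, zero_sub, zero_add]
        linarith
      · simp
    -- For `l = 0` the right side is `aμ`, and the integrand on the left is bounded by `aμ`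
    -- pointwise.
    rcases hl.eq_or_lt with rfl | hl
    · rw [hlin]
      have hle : ∫ s in (0 : ℝ)..1, (2 * b * (0 - μ) * ((1 - s) * x s) -
          d * (μ * ((1 - s) ^ 2 * x s ^ 2) + 0 * (s * (1 - s) * x s ^ 2))) ≤
          ∫ s in (0 : ℝ)..1, a * μ := by
        refine intervalIntegral.integral_mono_on zero_le_one hii (by simp) fun s hs => ?_
        have := quadratic_le (D := -1) (x := (1 - s) * x s) ha hd hb one_pos
        have := mul_le_mul_of_nonneg_left this hμ.le
        nlinarith
      simpa using hle
    · rw [hlin]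
      have hder : ∀ s ∈ Set.uIcc (0 : ℝ) 1, HasDerivAt (fun s : ℝ => a *
          (((1 - s) * μ + s * l) * Real.log ((1 - s) * μ + s * l) +
          (1 - s) * (l - μ) * (Real.log ((1 - s) * μ + s * l) + 1)))
          (a * ((1 - s) * ((l - μ) ^ 2 / ((1 - s) * μ + s * l)))) s := by
        intro s hs
        rw [Set.uIcc_of_le zero_le_one] at hs
        exact (hasDerivAt_entropy_remainder l μ s (hpos s hs l μ hl hμ)).const_mul a
      have hint : IntervalIntegrable
          (fun s => a * ((1 - s) * ((l - μ) ^ 2 / ((1 - s) * μ + s * l))))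
          MeasureTheory.volume 0 1 := by
        refine ContinuousOn.intervalIntegrable ?_
        rw [Set.uIcc_of_le zero_le_one]
        refine continuousOn_const.mul (ContinuousOn.mul (by fun_prop)
          (ContinuousOn.div (by fun_prop) (by fun_prop) fun s hs => ?_))
        exact (hpos s hs l μ hl hμ).ne'
      have hF := intervalIntegral.integral_eq_sub_of_hasDerivAt hder hint
      have hF' : a * (l * (Real.log l - Real.log μ) - l + μ) =
          ∫ s in (0 : ℝ)..1, a * ((1 - s) * ((l - μ) ^ 2 / ((1 - s) * μ + s * l))) := by
        rw [hF]
        simp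
        ring
      rw [hF']
      refine intervalIntegral.integral_mono_on zero_le_one hii hint fun s hs => ?_
      have := quadratic_le (D := l - μ) (x := x s) ha hd hb (hpos s hs l μ hl hμ)
      have := mul_le_mul_of_nonneg_left this (sub_nonneg.2 hs.2)
      nlinarith

/-! ### Diagonalisation and functional calculus -/

/-- `A = W diag(d) W†` for a unitary `W`, possibly between differently labelled bases. -/
structure Diagonalizes {ι κ : Type} [Fintype ι] [DecidableEq ι] [Fintype κ] [DecidableEq κ]
    (W : Matrix ι κ ℂ) (d : κ → ℝ) (A : Matrix ι ι ℂ) : Prop where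
  mul_conjTranspose : W * Wᴴ = 1
  conjTranspose_mul : Wᴴ * W = 1
  eq : A = W * Matrix.diagonal (fun k => (d k : ℂ)) * Wᴴ

variable {ι κ κ' : Type} [Fintype ι] [DecidableEq ι] [Fintype κ] [DecidableEq κ]
  [Fintype κ'] [DecidableEq κ']

lemma diagonalizes_eigenvectorUnitary {A : Matrix ι ι ℂ} (hA : A.IsHermitian) :
    Diagonalizes (hA.eigenvectorUnitary : Matrix ι ι ℂ) hA.eigenvalues A where
  mul_conjTranspose := Matrix.mem_unitaryGroup_iff.1 hA.eigenvectorUnitary.2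
  conjTranspose_mul := Matrix.mem_unitaryGroup_iff'.1 hA.eigenvectorUnitary.2
  eq := by
    conv_lhs => rw [hA.spectral_theorem]
    rfl

lemma Diagonalizes.isHermitian {W : Matrix ι κ ℂ} {d : κ → ℝ} {A : Matrix ι ι ℂ}
    (h : Diagonalizes W d A) : A.IsHermitian := by
  rw [h.eq]
  refine Matrix.isHermitian_mul_mul_conjTranspose _ ?_
  exact Matrix.isHermitian_diagonal_of_self_adjoint _ (by ext; simp)

lemma Diagonalizes.aeval {W : Matrix ι κ ℂ} {d : κ → ℝ} {A : Matrix ι ι ℂ}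
    (h : Diagonalizes W d A) (p : Polynomial ℝ) :
    Polynomial.aeval A p = W * Matrix.diagonal (fun k => ((p.eval (d k) : ℝ) : ℂ)) * Wᴴ := by
  induction p using Polynomial.induction_on' with
  | add p q hp hq =>
    simp only [map_add, hp, hq, Polynomial.eval_add, Complex.ofReal_add, ← Matrix.diagonal_add,
      Matrix.mul_add, Matrix.add_mul]
  | monomial n a =>
    have hpow : A ^ n = W * Matrix.diagonal (fun k => ((d k ^ n : ℝ) : ℂ)) * Wᴴ := by
      induction n with
      | zero => simp [h.mul_conjTranspose]
      | succ n ih =>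
        rw [pow_succ, ih, h.eq]
        calc _ = W * Matrix.diagonal (fun k => ((d k ^ n : ℝ) : ℂ)) * (Wᴴ * W) *
              Matrix.diagonal (fun k => (d k : ℂ)) * Wᴴ := by simp only [Matrix.mul_assoc]
          _ = _ := by
            rw [h.conjTranspose_mul, Matrix.mul_one, Matrix.mul_assoc W, Matrix.diagonal_mul_diagonal]
            simp [pow_succ]
    have hs : Matrix.diagonal (fun k => ((a * d k ^ n : ℝ) : ℂ)) =
        a • Matrix.diagonal (fun k => ((d k ^ n : ℝ) : ℂ)) := by
      ext i j
      by_cases hij : i = j <;> simp [Matrix.diagonal, hij]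
    rw [Polynomial.aeval_monomial, hpow, ← Algebra.smul_def]
    simp only [Polynomial.eval_monomial]
    rw [hs, Matrix.mul_smul, Matrix.smul_mul]

/-- On a finite set containing the spectrum and all `d k`, `f` agrees with its Lagrange interpolant,
so the polynomial case suffices. Any diagonalisation is allowed, in particular those of Kronecker
products built from their factors. -/
lemma Diagonalizes.cfc {W : Matrix ι κ ℂ} {d : κ → ℝ} {A : Matrix ι ι ℂ}
    (h : Diagonalizes W d A) (f : ℝ → ℝ) :
    _root_.cfc f A = W * Matrix.diagonal (fun k => (f (d k) : ℂ)) * Wᴴ := by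
  have hA : IsSelfAdjoint A := h.isHermitian
  set s : Finset ℝ := Finset.univ.image d ∪ (Matrix.finite_real_spectrum (A := A)).toFinset with hs
  set p : Polynomial ℝ := Lagrange.interpolate s id f with hp
  have heval : ∀ x ∈ s, p.eval x = f x := fun x hx =>
    Lagrange.eval_interpolate_at_node (v := id) f Function.injective_id.injOn hx
  have h1 : _root_.cfc f A = _root_.cfc p.eval A := by
    refine cfc_congr fun x hx => (heval x ?_).symm
    simp only [hs, Finset.mem_union, Set.Finite.mem_toFinset]
    exact Or.inr hx
  rw [h1, cfc_polynomial p A hA, h.aeval p]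
  congr 3
  ext k
  rw [heval (d k) (by simp [hs])]

/-! ### Overlap formulas -/

/-- Insert `V * Vᴴ = 1` between `A` and `Bᴴ`. With `A` and `B` among `1` and an effect, this puts
every trace in the variational bound on the same pairs of eigenvectors. -/
lemma Diagonalizes.trace_mul_mul {U : Matrix ι κ ℂ} {l : κ → ℝ} {ρ : Matrix ι ι ℂ}
    (h : Diagonalizes U l ρ) {V : Matrix ι κ' ℂ} (hV : V * Vᴴ = 1) (A B : Matrix ι ι ℂ) :
    (ρ * A * Bᴴ).trace =
      ∑ i, ∑ j, (l i : ℂ) * ((Uᴴ * A * V) i j * star ((Uᴴ * B * V) i j)) := by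
  have h1 : (ρ * A * Bᴴ).trace =
      (Matrix.diagonal (fun k => (l k : ℂ)) * ((Uᴴ * A * V) * (Uᴴ * B * V)ᴴ)).trace := by
    rw [h.eq, Matrix.conjTranspose_mul, Matrix.conjTranspose_mul, Matrix.conjTranspose_conjTranspose]
    calc _ = (U * (Matrix.diagonal (fun k => (l k : ℂ)) * Uᴴ * A * (V * Vᴴ) * Bᴴ)).trace := by
            rw [hV]; simp only [Matrix.mul_assoc, Matrix.one_mul]
      _ = _ := by rw [Matrix.trace_mul_comm]; simp only [Matrix.mul_assoc]
  rw [h1, Matrix.trace]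
  refine Finset.sum_congr rfl fun i _ => ?_
  rw [Matrix.diag_apply, Matrix.diagonal_mul, Matrix.mul_apply, Finset.mul_sum]
  simp [Matrix.conjTranspose_apply]

lemma Diagonalizes.trace_mul_cfc {U : Matrix ι κ ℂ} {l : κ → ℝ} {ρ : Matrix ι ι ℂ}
    (h : Diagonalizes U l ρ) {V : Matrix ι κ' ℂ} {μ : κ' → ℝ} {σ : Matrix ι ι ℂ}
    (h' : Diagonalizes V μ σ) (f : ℝ → ℝ) :
    (ρ * _root_.cfc f σ).trace.re = ∑ i, ∑ j, ‖(Uᴴ * V) i j‖ ^ 2 * (l i * f (μ j)) := by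
  have h1 := h.trace_mul_mul h'.mul_conjTranspose (_root_.cfc f σ) 1
  rw [Matrix.conjTranspose_one, Matrix.mul_one] at h1
  rw [h1, Complex.re_sum]
  refine Finset.sum_congr rfl fun i _ => ?_
  rw [Complex.re_sum]
  refine Finset.sum_congr rfl fun j _ => ?_
  have h2 : Uᴴ * _root_.cfc f σ * V = Uᴴ * V * Matrix.diagonal (fun k => (f (μ k) : ℂ)) := by
    rw [h'.cfc f]
    calc _ = Uᴴ * V * Matrix.diagonal (fun k => (f (μ k) : ℂ)) * (Vᴴ * V) := by
            simp only [Matrix.mul_assoc]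
      _ = _ := by rw [h'.conjTranspose_mul, Matrix.mul_one]
  rw [h2, Matrix.mul_diagonal, Matrix.mul_one]
  have h3 : (l i : ℂ) * ((Uᴴ * V) i j * (f (μ j) : ℂ) * star ((Uᴴ * V) i j)) =
      ((l i * f (μ j) : ℝ) : ℂ) * ((Uᴴ * V) i j * (starRingEnd ℂ) ((Uᴴ * V) i j)) := by
    push_cast
    simp only [starRingEnd_apply]
    ring
  rw [h3, Complex.mul_conj, ← Complex.ofReal_mul, Complex.ofReal_re, Complex.normSq_eq_norm_sq]
  ring

/-- The entrywise form of the support condition is the one that passes easily to Kronecker products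
and relabelled bases, and it tells which terms of the overlap sums vanish. -/
lemma Diagonalizes.kernel_le_iff {U : Matrix ι κ ℂ} {l : κ → ℝ} {ρ : Matrix ι ι ℂ}
    (h : Diagonalizes U l ρ) {V : Matrix ι κ' ℂ} {μ : κ' → ℝ} {σ : Matrix ι ι ℂ}
    (h' : Diagonalizes V μ σ) :
    (∀ v : ι → ℂ, σ *ᵥ v = 0 → ρ *ᵥ v = 0) ↔ ∀ i j, μ j = 0 → l i = 0 ∨ (Uᴴ * V) i j = 0 := by
  have hU : ∀ v : ι → ℂ, ρ *ᵥ v = 0 ↔ ∀ i, (l i : ℂ) * (Uᴴ *ᵥ v) i = 0 := by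
    intro v
    have : Uᴴ *ᵥ (ρ *ᵥ v) = fun i => (l i : ℂ) * (Uᴴ *ᵥ v) i := by
      rw [h.eq, Matrix.mulVec_mulVec, ← Matrix.mul_assoc, ← Matrix.mul_assoc, h.conjTranspose_mul,
        Matrix.one_mul, ← Matrix.mulVec_mulVec]
      ext i
      rw [Matrix.mulVec_diagonal]
    constructor
    · intro hv i
      rw [hv, Matrix.mulVec_zero] at this
      exact (congrFun this i).symm
    · intro hv
      have h0 : Uᴴ *ᵥ (ρ *ᵥ v) = 0 := by rw [this]; ext i; exact hv i
      rw [← Matrix.one_mulVec (ρ *ᵥ v), ← h.mul_conjTranspose, ← Matrix.mulVec_mulVec, h0,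
        Matrix.mulVec_zero]
  have hV : ∀ v : ι → ℂ, σ *ᵥ v = 0 ↔ ∀ i, (μ i : ℂ) * (Vᴴ *ᵥ v) i = 0 := by
    intro v
    have : Vᴴ *ᵥ (σ *ᵥ v) = fun i => (μ i : ℂ) * (Vᴴ *ᵥ v) i := by
      rw [h'.eq, Matrix.mulVec_mulVec, ← Matrix.mul_assoc, ← Matrix.mul_assoc,
        h'.conjTranspose_mul, Matrix.one_mul, ← Matrix.mulVec_mulVec]
      ext i
      rw [Matrix.mulVec_diagonal]
    constructor
    · intro hv i
      rw [hv, Matrix.mulVec_zero] at this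
      exact (congrFun this i).symm
    · intro hv
      have h0 : Vᴴ *ᵥ (σ *ᵥ v) = 0 := by rw [this]; ext i; exact hv i
      rw [← Matrix.one_mulVec (σ *ᵥ v), ← h'.mul_conjTranspose, ← Matrix.mulVec_mulVec, h0,
        Matrix.mulVec_zero]
  constructor
  · intro hk i j hj
    have h1 : σ *ᵥ (V *ᵥ Pi.single j 1) = 0 := by
      rw [hV]
      intro k
      rw [Matrix.mulVec_mulVec, h'.conjTranspose_mul, Matrix.one_mulVec]
      by_cases hkj : k = j
      · simp [hkj, hj]
      · simp [hkj]
    have h2 := (hU _).1 (hk _ h1) i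
    rw [Matrix.mulVec_mulVec, Matrix.mulVec_single_one] at h2
    simpa using h2
  · intro hk v hv
    rw [hV] at hv
    rw [hU]
    intro i
    have h1 : Uᴴ *ᵥ v = (Uᴴ * V) *ᵥ (Vᴴ *ᵥ v) := by
      rw [Matrix.mulVec_mulVec, Matrix.mul_assoc, h'.mul_conjTranspose, Matrix.mul_one]
    rw [h1, Matrix.mulVec, dotProduct, Finset.mul_sum]
    refine Finset.sum_eq_zero fun j _ => ?_
    rcases mul_eq_zero.1 (hv j) with hj | hj
    · rcases hk i j (by exact_mod_cast hj) with h0 | h0 <;> simp [h0]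
    · simp [hj]

/-! ### Relative entropy in terms of overlaps -/

/-- The relative entropy of two spectra whose eigenbases have overlaps `c`. -/
noncomputable def overlapEntropy (c : Matrix κ κ' ℂ) (l : κ → ℝ) (μ : κ' → ℝ) : ℝ :=
  ∑ i, ∑ j, ‖c i j‖ ^ 2 * (l i * (Real.logb 2 (l i) - Real.logb 2 (μ j)))

lemma sum_norm_sq_eq_one {V : Matrix ι κ' ℂ} (hV : V * Vᴴ = 1) {U : Matrix ι κ ℂ}
    (hU : Uᴴ * U = 1) (i : κ) : ∑ j, ‖(Uᴴ * V) i j‖ ^ 2 = 1 := by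
  have h1 : (Uᴴ * V) * (Uᴴ * V)ᴴ = 1 := by
    rw [Matrix.conjTranspose_mul, Matrix.conjTranspose_conjTranspose, Matrix.mul_assoc,
      ← Matrix.mul_assoc V, hV, Matrix.one_mul, hU]
  have h2 := congrFun (congrFun h1 i) i
  rw [Matrix.mul_apply, Matrix.one_apply_eq] at h2
  have h3 : ∀ j, (Uᴴ * V) i j * (Uᴴ * V)ᴴ j i = ((‖(Uᴴ * V) i j‖ ^ 2 : ℝ) : ℂ) := by
    intro j
    rw [Matrix.conjTranspose_apply, ← starRingEnd_apply, Complex.mul_conj,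
      Complex.normSq_eq_norm_sq]
  simp only [h3] at h2
  exact_mod_cast h2

lemma Diagonalizes.trace_mul_log_sub_log {U : Matrix ι κ ℂ} {l : κ → ℝ} {ρ : Matrix ι ι ℂ}
    (h : Diagonalizes U l ρ) {V : Matrix ι κ' ℂ} {μ : κ' → ℝ} {σ : Matrix ι ι ℂ}
    (h' : Diagonalizes V μ σ) :
    (ρ * (_root_.cfc (Real.logb 2) ρ - _root_.cfc (Real.logb 2) σ)).trace.re =
      overlapEntropy (Uᴴ * V) l μ := by
  rw [mul_sub, Matrix.trace_sub, Complex.sub_re, h.trace_mul_cfc h', h.trace_mul_cfc h,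
    overlapEntropy, h.conjTranspose_mul, ← Finset.sum_sub_distrib]
  refine Finset.sum_congr rfl fun i _ => ?_
  -- The overlap matrix of an eigenbasis with itself is the identity, while the rows of `Uᴴ * V` are
  -- normalised; so `tr ρ log ρ` can be spread over the same pairs as `tr ρ log σ`.
  have h1 : ∑ j, ‖(1 : Matrix κ κ ℂ) i j‖ ^ 2 * (l i * Real.logb 2 (l j)) =
      ∑ j, ‖(Uᴴ * V) i j‖ ^ 2 * (l i * Real.logb 2 (l i)) := by
    rw [← Finset.sum_mul, sum_norm_sq_eq_one h'.mul_conjTranspose h.conjTranspose_mul, one_mul,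
      Finset.sum_eq_single i]
    · simp
    · intro j _ hj
      simp [Matrix.one_apply_ne hj.symm]
    · simp
  rw [h1, ← Finset.sum_sub_distrib]
  refine Finset.sum_congr rfl fun j _ => ?_
  ring

lemma Diagonalizes.relativeEntropy_eq {U : Matrix ι κ ℂ} {l : κ → ℝ} {ρ : Matrix ι ι ℂ}
    (h : Diagonalizes U l ρ) {V : Matrix ι κ' ℂ} {μ : κ' → ℝ} {σ : Matrix ι ι ℂ}
    (h' : Diagonalizes V μ σ) (hk : ∀ i j, μ j = 0 → l i = 0 ∨ (Uᴴ * V) i j = 0) :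
    relativeEntropy ρ σ = (overlapEntropy (Uᴴ * V) l μ : ℝ) := by
  rw [relativeEntropy, if_pos ((h.kernel_le_iff h').2 hk), h.trace_mul_log_sub_log h']

lemma relativeEntropy_ne_bot (ρ σ : Matrix ι ι ℂ) : relativeEntropy ρ σ ≠ ⊥ := by
  unfold relativeEntropy
  split_ifs <;> simp

/-! ### Measuring a binary observable -/

lemma trace_mul_nonneg {A B : Matrix ι ι ℂ} (hA : A.PosSemidef) (hB : B.PosSemidef) :
    0 ≤ (A * B).trace := by
  obtain ⟨m, v, rfl⟩ := Matrix.posSemidef_iff_eq_sum_vecMulVec.1 hB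
  rw [Finset.mul_sum, Matrix.trace_sum]
  refine Finset.sum_nonneg fun i _ => ?_
  rw [Matrix.mul_vecMulVec, Matrix.trace_vecMulVec, dotProduct_comm]
  exact hA.dotProduct_mulVec_nonneg _

lemma trace_mul_sq_le {σ M : Matrix ι ι ℂ} (hσ : σ.PosSemidef) (hM : M.PosSemidef)
    (hM' : (1 - M).PosSemidef) : (σ * M * M).trace.re ≤ (σ * M).trace.re := by
  have h1 : (M - M * M).PosSemidef := by
    have : M - M * M = Mᴴ * (1 - M) * M + (1 - M)ᴴ * M * (1 - M) := by
      rw [hM.isHermitian, hM'.isHermitian]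
      noncomm_ring
    rw [this]
    exact (hM'.conjTranspose_mul_mul_same M).add (hM.conjTranspose_mul_mul_same (1 - M))
  have h2 := (Complex.le_def.1 (trace_mul_nonneg hσ h1)).1
  rw [mul_sub, Matrix.trace_sub, ← mul_assoc] at h2
  simpa using h2

/-- The variational lower bound on the relative entropy given by a binary measurement. -/
theorem measured_le_relativeEntropy {ρ σ M : Matrix ι ι ℂ} (hρ : IsState ρ) (hσ : IsState σ)
    (hM : M.PosSemidef) (hM' : (1 - M).PosSemidef) {n : ℝ} (hn : 1 ≤ n) :
    (((ρ * M).trace.re * Real.logb 2 n + (σ * M).trace.re * (1 - n) / Real.log 2 : ℝ) : EReal) ≤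
      relativeEntropy ρ σ := by
  set U := (hρ.1.isHermitian.eigenvectorUnitary : Matrix ι ι ℂ)
  set V := (hσ.1.isHermitian.eigenvectorUnitary : Matrix ι ι ℂ)
  set l := hρ.1.isHermitian.eigenvalues
  set μ := hσ.1.isHermitian.eigenvalues
  have hU : Diagonalizes U l ρ := diagonalizes_eigenvectorUnitary _
  have hV : Diagonalizes V μ σ := diagonalizes_eigenvectorUnitary _
  have hl : ∀ i, 0 ≤ l i := hρ.1.eigenvalues_nonneg
  have hμ : ∀ i, 0 ≤ μ i := hσ.1.eigenvalues_nonneg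
  by_cases hk : ∀ i j, μ j = 0 → l i = 0 ∨ (Uᴴ * V) i j = 0
  swap
  · rw [relativeEntropy, if_neg (by rwa [hU.kernel_le_iff hV])]
    exact le_top
  rw [hU.relativeEntropy_eq hV hk]
  obtain ⟨I₁, I₂, I₃, hI₂, hI₃, hlog, hlin, hle⟩ := exists_entropy_tangent hn
  set c := Uᴴ * V with hc
  set m := Uᴴ * M * V with hm
  -- The tangent bound with `a = |c|²`, `b = Re(c m̄)`, `d = |m|²`, where `c` and `m` are the matrix
  -- elements of `1` and `M` between the eigenbases; `b² ≤ ad` since `|Re z| ≤ |z|`.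
  have h1 : ∀ i j, 2 * (c i j * star (m i j)).re * (l i - μ j) * I₁ -
      ‖m i j‖ ^ 2 * (μ j * I₂ + l i * I₃) ≤
      ‖c i j‖ ^ 2 * (l i * (Real.log (l i) - Real.log (μ j)) - l i + μ j) := by
    intro i j
    refine hle _ _ _ _ _ (by positivity) (by positivity) ?_ (hl i) (hμ j) ?_
    · rw [← mul_pow, sq_le_sq, abs_of_nonneg (by positivity : 0 ≤ ‖c i j‖ * ‖m i j‖)]
      refine (Complex.abs_re_le_norm _).trans ?_
      rw [norm_mul, norm_star]
    · intro h0
      rcases hk i j h0 with h | h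
      · exact Or.inr h
      · exact Or.inl (by simp [h])
  have hUV : ∀ A B : Matrix ι ι ℂ, (ρ * A * Bᴴ).trace.re =
      ∑ i, ∑ j, l i * ((Uᴴ * A * V) i j * star ((Uᴴ * B * V) i j)).re := by
    intro A B
    rw [hU.trace_mul_mul hV.mul_conjTranspose, Complex.re_sum]
    refine Finset.sum_congr rfl fun i _ => ?_
    rw [Complex.re_sum]
    exact Finset.sum_congr rfl fun j _ => Complex.re_ofReal_mul _ _
  have hVU : ∀ A B : Matrix ι ι ℂ, (σ * Aᴴ * B).trace.re =
      ∑ i, ∑ j, μ j * ((Uᴴ * A * V) i j * star ((Uᴴ * B * V) i j)).re := by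
    intro A B
    have h2 := hV.trace_mul_mul hU.mul_conjTranspose Aᴴ Bᴴ
    rw [Matrix.conjTranspose_conjTranspose] at h2
    rw [h2, Finset.sum_comm, Complex.re_sum]
    refine Finset.sum_congr rfl fun i _ => ?_
    rw [Complex.re_sum]
    refine Finset.sum_congr rfl fun j _ => ?_
    rw [Complex.re_ofReal_mul]
    have h3 : ∀ C : Matrix ι ι ℂ, (Vᴴ * Cᴴ * U) j i = star ((Uᴴ * C * V) i j) := by
      intro C
      rw [← Matrix.conjTranspose_apply, Matrix.conjTranspose_mul, Matrix.conjTranspose_mul,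
        Matrix.conjTranspose_conjTranspose, Matrix.mul_assoc]
    rw [h3, h3, star_star]
    simp [mul_comm]
  have nsq : ∀ z : ℂ, (z * star z).re = ‖z‖ ^ 2 := by
    intro z
    rw [← starRingEnd_apply, Complex.mul_conj, Complex.ofReal_re, Complex.normSq_eq_norm_sq]
  -- The traces of `ρM`, `ρM²`, `ρ` and of `σM`, `σM²`, `σ` as weighted overlap sums.
  have e1 := hUV 1 M
  have e2 := hUV M M
  have e3 := hUV 1 1
  have f1 := hVU 1 M
  have f2 := hVU M M
  have f3 := hVU 1 1
  simp only [Matrix.conjTranspose_one, Matrix.mul_one, hM.isHermitian.eq, ← hc, ← hm, nsq]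
    at e1 e2 e3 f1 f2 f3
  rw [hρ.2] at e3
  rw [hσ.2] at f3
  have g1 := trace_mul_sq_le hρ.1 hM hM'
  have g2 := trace_mul_sq_le hσ.1 hM hM'
  have hsum := Finset.sum_le_sum fun i (_ : i ∈ Finset.univ) =>
    Finset.sum_le_sum fun j (_ : j ∈ Finset.univ) => h1 i j
  have hL : ∑ i, ∑ j, (2 * (c i j * star (m i j)).re * (l i - μ j) * I₁ -
      ‖m i j‖ ^ 2 * (μ j * I₂ + l i * I₃)) =
      2 * I₁ * (ρ * M).trace.re - 2 * I₁ * (σ * M).trace.re - (I₂ * (σ * M * M).trace.re +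
        I₃ * (ρ * M * M).trace.re) := by
    rw [e1, e2, f1, f2]
    simp only [Finset.mul_sum, ← Finset.sum_sub_distrib, ← Finset.sum_add_distrib]
    refine Finset.sum_congr rfl fun i _ => Finset.sum_congr rfl fun j _ => ?_
    ring
  have hR : ∑ i, ∑ j, ‖c i j‖ ^ 2 * (l i * (Real.log (l i) - Real.log (μ j)) - l i + μ j) =
      Real.log 2 * overlapEntropy c l μ := by
    have : ∑ i, ∑ j, ‖c i j‖ ^ 2 * (l i * (Real.log (l i) - Real.log (μ j)) - l i + μ j) =
        Real.log 2 * overlapEntropy c l μ - ∑ i, ∑ j, l i * ‖c i j‖ ^ 2 +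
          ∑ i, ∑ j, μ j * ‖c i j‖ ^ 2 := by
      rw [overlapEntropy]
      simp only [Finset.mul_sum, ← Finset.sum_sub_distrib, ← Finset.sum_add_distrib]
      refine Finset.sum_congr rfl fun i _ => Finset.sum_congr rfl fun j _ => ?_
      have hlog2 : Real.log 2 ≠ 0 := (Real.log_pos one_lt_two).ne'
      simp only [Real.logb]
      field_simp
    rw [this, ← e3, ← f3]
    ring
  rw [hL, hR] at hsum
  rw [EReal.coe_le_coe_iff]
  have hlog2 : 0 < Real.log 2 := Real.log_pos one_lt_two
  -- As `I₂` and `I₃` are nonnegative and enter with a minus sign, `M² ≤ M` lets `M` replace `M²`;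
  -- what remains is linear in `tr ρM` and `tr σM`, with coefficients `log n` and `1 - n`.
  have hg1 := mul_le_mul_of_nonneg_left g1 hI₃
  have hg2 := mul_le_mul_of_nonneg_left g2 hI₂
  have hfin : (ρ * M).trace.re * Real.log n + (σ * M).trace.re * (1 - n) ≤
      Real.log 2 * overlapEntropy c l μ := by
    have hn' : 1 - n = -(2 * I₁ + I₂) := by linarith
    rw [← hlog, hn']
    linarith
  rw [Real.logb, ← mul_div_assoc, ← add_div, div_le_iff₀ hlog2]
  linarith

lemma relativeEntropy_nonneg {ρ σ : Matrix ι ι ℂ} (hρ : IsState ρ) (hσ : IsState σ) :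
    0 ≤ relativeEntropy ρ σ := by
  -- The trivial effect `M = 0` with `n = 1` makes the lower bound zero.
  have h := measured_le_relativeEntropy hρ hσ (M := 0) Matrix.PosSemidef.zero
    (by simpa using Matrix.PosSemidef.one) le_rfl
  simpa using h

/-! ### Additivity of the relative entropy -/

section Additivity

variable {ι₁ ι₂ κ₁ κ₂ κ₁' κ₂' : Type} [Fintype ι₁] [DecidableEq ι₁] [Fintype ι₂] [DecidableEq ι₂]
  [Fintype κ₁] [DecidableEq κ₁] [Fintype κ₂] [DecidableEq κ₂]
  [Fintype κ₁'] [DecidableEq κ₁'] [Fintype κ₂'] [DecidableEq κ₂']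

lemma Diagonalizes.kronecker {W₁ : Matrix ι₁ κ₁ ℂ} {d₁ : κ₁ → ℝ} {A₁ : Matrix ι₁ ι₁ ℂ}
    {W₂ : Matrix ι₂ κ₂ ℂ} {d₂ : κ₂ → ℝ} {A₂ : Matrix ι₂ ι₂ ℂ}
    (h₁ : Diagonalizes W₁ d₁ A₁) (h₂ : Diagonalizes W₂ d₂ A₂) :
    Diagonalizes (W₁ ⊗ₖ W₂) (fun k => d₁ k.1 * d₂ k.2) (A₁ ⊗ₖ A₂) where
  mul_conjTranspose := by
    rw [Matrix.conjTranspose_kronecker, ← Matrix.mul_kronecker_mul, h₁.mul_conjTranspose,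
      h₂.mul_conjTranspose, Matrix.one_kronecker_one]
  conjTranspose_mul := by
    rw [Matrix.conjTranspose_kronecker, ← Matrix.mul_kronecker_mul, h₁.conjTranspose_mul,
      h₂.conjTranspose_mul, Matrix.one_kronecker_one]
  eq := by
    conv_lhs => rw [h₁.eq, h₂.eq]
    rw [Matrix.mul_kronecker_mul, Matrix.mul_kronecker_mul, Matrix.diagonal_kronecker_diagonal,
      Matrix.conjTranspose_kronecker]
    simp

lemma Diagonalizes.submatrix {W : Matrix ι₁ κ₁ ℂ} {d : κ₁ → ℝ} {A : Matrix ι₁ ι₁ ℂ}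
    (h : Diagonalizes W d A) (e : ι₂ ≃ ι₁) :
    Diagonalizes (W.submatrix e id) d (A.submatrix e e) where
  mul_conjTranspose := by
    rw [Matrix.conjTranspose_submatrix, ← Matrix.submatrix_mul _ _ _ _ _ Function.bijective_id,
      h.mul_conjTranspose, Matrix.submatrix_one_equiv]
  conjTranspose_mul := by
    rw [Matrix.conjTranspose_submatrix, ← Matrix.submatrix_mul _ _ _ _ _ e.bijective,
      h.conjTranspose_mul, Matrix.submatrix_id_id]
  eq := by
    conv_lhs => rw [h.eq]
    rw [Matrix.conjTranspose_submatrix,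
      Matrix.submatrix_mul _ _ _ (id : κ₁ → κ₁) _ Function.bijective_id,
      Matrix.submatrix_mul _ _ _ (id : κ₁ → κ₁) _ Function.bijective_id, Matrix.submatrix_id_id]

/-- Relabelling permutes the rows of both eigenvector matrices simultaneously, so the spectra and
overlaps do not change. -/
lemma relativeEntropy_submatrix (ρ σ : Matrix ι₁ ι₁ ℂ) (hρ : ρ.IsHermitian) (hσ : σ.IsHermitian)
    (e : ι₂ ≃ ι₁) :
    relativeEntropy (ρ.submatrix e e) (σ.submatrix e e) = relativeEntropy ρ σ := by
  have h := diagonalizes_eigenvectorUnitary hρ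
  have h' := diagonalizes_eigenvectorUnitary hσ
  have hc : ((hρ.eigenvectorUnitary : Matrix ι₁ ι₁ ℂ).submatrix e id)ᴴ *
      (hσ.eigenvectorUnitary : Matrix ι₁ ι₁ ℂ).submatrix e id =
      (hρ.eigenvectorUnitary : Matrix ι₁ ι₁ ℂ)ᴴ * (hσ.eigenvectorUnitary : Matrix ι₁ ι₁ ℂ) := by
    rw [Matrix.conjTranspose_submatrix, ← Matrix.submatrix_mul _ _ _ _ _ e.bijective,
      Matrix.submatrix_id_id]
  by_cases hk : ∀ i j, hσ.eigenvalues j = 0 → hρ.eigenvalues i = 0 ∨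
      ((hρ.eigenvectorUnitary : Matrix ι₁ ι₁ ℂ)ᴴ * (hσ.eigenvectorUnitary : Matrix ι₁ ι₁ ℂ)) i j = 0
  · rw [h.relativeEntropy_eq h' hk,
      (h.submatrix e).relativeEntropy_eq (h'.submatrix e) (by rwa [hc]), hc]
  · have h1 := hk
    rw [← h.kernel_le_iff h'] at hk
    rw [← hc, ← (h.submatrix e).kernel_le_iff (h'.submatrix e)] at h1
    rw [relativeEntropy, relativeEntropy, if_neg hk, if_neg h1]

lemma overlapEntropy_kronecker {c₁ : Matrix κ₁ κ₁' ℂ} {l₁ : κ₁ → ℝ} {μ₁ : κ₁' → ℝ}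
    {c₂ : Matrix κ₂ κ₂' ℂ} {l₂ : κ₂ → ℝ} {μ₂ : κ₂' → ℝ}
    (h₁ : ∀ i j, μ₁ j = 0 → l₁ i = 0 ∨ c₁ i j = 0) (h₂ : ∀ i j, μ₂ j = 0 → l₂ i = 0 ∨ c₂ i j = 0)
    (s₁ : ∑ i, ∑ j, ‖c₁ i j‖ ^ 2 * l₁ i = 1) (s₂ : ∑ i, ∑ j, ‖c₂ i j‖ ^ 2 * l₂ i = 1) :
    overlapEntropy (c₁ ⊗ₖ c₂) (fun k => l₁ k.1 * l₂ k.2) (fun k => μ₁ k.1 * μ₂ k.2) =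
      overlapEntropy c₁ l₁ μ₁ + overlapEntropy c₂ l₂ μ₂ := by
  have hterm : ∀ i₁ i₂ j₁ j₂, ‖c₁ i₁ j₁ * c₂ i₂ j₂‖ ^ 2 * (l₁ i₁ * l₂ i₂ *
      (Real.logb 2 (l₁ i₁ * l₂ i₂) - Real.logb 2 (μ₁ j₁ * μ₂ j₂))) =
      ‖c₁ i₁ j₁‖ ^ 2 * (l₁ i₁ * (Real.logb 2 (l₁ i₁) - Real.logb 2 (μ₁ j₁))) *
        (‖c₂ i₂ j₂‖ ^ 2 * l₂ i₂) + ‖c₁ i₁ j₁‖ ^ 2 * l₁ i₁ *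
        (‖c₂ i₂ j₂‖ ^ 2 * (l₂ i₂ * (Real.logb 2 (l₂ i₂) - Real.logb 2 (μ₂ j₂)))) := by
    intro i₁ i₂ j₁ j₂
    -- The logarithm of a product splits only for nonzero factors. In every other case the weight
    -- vanishes, by the support conditions when some `μ` is zero.
    by_cases a₁ : l₁ i₁ = 0
    · simp [a₁]
    by_cases a₂ : l₂ i₂ = 0
    · simp [a₂]
    by_cases b₁ : c₁ i₁ j₁ = 0
    · simp [b₁]
    by_cases b₂ : c₂ i₂ j₂ = 0
    · simp [b₂]
    have m₁ : μ₁ j₁ ≠ 0 := fun h => (h₁ i₁ j₁ h).elim a₁ b₁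
    have m₂ : μ₂ j₂ ≠ 0 := fun h => (h₂ i₂ j₂ h).elim a₂ b₂
    rw [Real.logb_mul a₁ a₂, Real.logb_mul m₁ m₂, norm_mul]
    ring
  have hprod : ∀ (f : κ₁ → κ₁' → ℝ) (g : κ₂ → κ₂' → ℝ),
      ∑ i₁, ∑ i₂, ∑ j₁, ∑ j₂, f i₁ j₁ * g i₂ j₂ = (∑ i, ∑ j, f i j) * ∑ i, ∑ j, g i j := by
    intro f g
    rw [Finset.sum_mul_sum]
    refine Finset.sum_congr rfl fun i₁ _ => Finset.sum_congr rfl fun i₂ _ => ?_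
    rw [Finset.sum_mul_sum]
  rw [overlapEntropy]
  simp only [Fintype.sum_prod_type, Matrix.kroneckerMap_apply, hterm, Finset.sum_add_distrib]
  rw [hprod, hprod, s₁, s₂, one_mul, mul_one, overlapEntropy, overlapEntropy]

lemma Diagonalizes.sum_overlap {U : Matrix ι₁ κ₁ ℂ} {l : κ₁ → ℝ} {ρ : Matrix ι₁ ι₁ ℂ}
    (h : Diagonalizes U l ρ) (hρ : ρ.trace = 1) {V : Matrix ι₁ κ₁' ℂ} (hV : V * Vᴴ = 1) :
    ∑ i, ∑ j, ‖(Uᴴ * V) i j‖ ^ 2 * l i = 1 := by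
  have h1 : (∑ i, (l i : ℂ)) = 1 := by
    rw [← hρ, h.eq, Matrix.trace_mul_comm, ← Matrix.mul_assoc, h.conjTranspose_mul, Matrix.one_mul,
      Matrix.trace_diagonal]
  simp only [← Finset.sum_mul, sum_norm_sq_eq_one hV h.conjTranspose_mul, one_mul]
  exact_mod_cast h1

/-- If a support condition fails the right side is `⊤`; otherwise the products of eigenvectors
diagonalise both Kronecker products and the overlap sums add. Subadditivity of `E_R` needs only this
direction. -/
lemma relativeEntropy_kronecker_le {ρ₁ σ₁ : Matrix ι₁ ι₁ ℂ} {ρ₂ σ₂ : Matrix ι₂ ι₂ ℂ}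
    (hρ₁ : IsState ρ₁) (hσ₁ : IsState σ₁) (hρ₂ : IsState ρ₂) (hσ₂ : IsState σ₂) :
    relativeEntropy (ρ₁ ⊗ₖ ρ₂) (σ₁ ⊗ₖ σ₂) ≤ relativeEntropy ρ₁ σ₁ + relativeEntropy ρ₂ σ₂ := by
  have u₁ := diagonalizes_eigenvectorUnitary hρ₁.1.isHermitian
  have v₁ := diagonalizes_eigenvectorUnitary hσ₁.1.isHermitian
  have u₂ := diagonalizes_eigenvectorUnitary hρ₂.1.isHermitian
  have v₂ := diagonalizes_eigenvectorUnitary hσ₂.1.isHermitian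
  by_cases k₁ : ∀ v : ι₁ → ℂ, σ₁ *ᵥ v = 0 → ρ₁ *ᵥ v = 0
  swap
  · have : relativeEntropy ρ₁ σ₁ = ⊤ := if_neg k₁
    rw [this, EReal.top_add_of_ne_bot (relativeEntropy_ne_bot _ _)]
    exact le_top
  by_cases k₂ : ∀ v : ι₂ → ℂ, σ₂ *ᵥ v = 0 → ρ₂ *ᵥ v = 0
  swap
  · have : relativeEntropy ρ₂ σ₂ = ⊤ := if_neg k₂
    rw [this, EReal.add_top_of_ne_bot (relativeEntropy_ne_bot _ _)]
    exact le_top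
  rw [u₁.kernel_le_iff v₁] at k₁
  rw [u₂.kernel_le_iff v₂] at k₂
  have hc : ∀ (A₁ B₁ : Matrix ι₁ ι₁ ℂ) (A₂ B₂ : Matrix ι₂ ι₂ ℂ),
      (A₁ ⊗ₖ A₂)ᴴ * (B₁ ⊗ₖ B₂) = (A₁ᴴ * B₁) ⊗ₖ (A₂ᴴ * B₂) := by
    intro A₁ B₁ A₂ B₂
    rw [Matrix.conjTranspose_kronecker, ← Matrix.mul_kronecker_mul]
  rw [u₁.relativeEntropy_eq v₁ k₁, u₂.relativeEntropy_eq v₂ k₂,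
    (u₁.kronecker u₂).relativeEntropy_eq (v₁.kronecker v₂), hc,
    overlapEntropy_kronecker k₁ k₂ (u₁.sum_overlap hρ₁.2 v₁.mul_conjTranspose)
      (u₂.sum_overlap hρ₂.2 v₂.mul_conjTranspose), EReal.coe_add]
  rw [hc]
  rintro ⟨i₁, i₂⟩ ⟨j₁, j₂⟩ h
  rw [Matrix.kroneckerMap_apply]
  rcases mul_eq_zero.1 h with h | h
  · rcases k₁ i₁ j₁ h with h | h <;> simp [h]
  · rcases k₂ i₂ j₂ h with h | h <;> simp [h]

end Additivity

/-! ### States and separable states -/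

section States

variable {ι ι' c a c₁ a₁ c₂ a₂ : Type} [Fintype ι] [Fintype ι'] [Fintype c] [Fintype a]
  [Fintype c₁] [Fintype a₁] [Fintype c₂] [Fintype a₂]

lemma IsState.kronecker {ρ : Matrix ι ι ℂ} {ρ' : Matrix ι' ι' ℂ} (h : IsState ρ)
    (h' : IsState ρ') : IsState (ρ ⊗ₖ ρ') :=
  ⟨h.1.kronecker h'.1, by rw [Matrix.trace_kronecker, h.2, h'.2, one_mul]⟩

lemma trace_submatrix_equiv (X : Matrix ι ι ℂ) (e : ι' ≃ ι) :
    (X.submatrix e e).trace = X.trace :=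
  Equiv.sum_comp e fun i => X i i

lemma IsState.submatrix {ρ : Matrix ι ι ℂ} (h : IsState ρ) (e : ι' ≃ ι) :
    IsState (ρ.submatrix e e) :=
  ⟨h.1.submatrix e, by rw [trace_submatrix_equiv, h.2]⟩

lemma IsState.nonempty {ρ : Matrix ι ι ℂ} (h : IsState ρ) : Nonempty ι := by
  by_contra hne
  rw [not_nonempty_iff] at hne
  have := h.2
  simp [Matrix.trace] at this

lemma convex_isState : Convex ℝ {ρ : Matrix ι ι ℂ | IsState ρ} := by
  intro x hx y hy s t hs ht hst
  refine ⟨(hx.1.smul hs).add (hy.1.smul ht), ?_⟩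
  rw [Matrix.trace_add, Matrix.trace_smul, Matrix.trace_smul, hx.2, hy.2, ← add_smul, hst, one_smul]

lemma isState_of_mem_separableStates {σ : Matrix (c × a) (c × a) ℂ}
    (h : σ ∈ separableStates c a) : IsState σ := by
  refine convexHull_min ?_ convex_isState h
  rintro _ ⟨α, β, hα, hβ, rfl⟩
  exact hα.kronecker hβ

/-- The regrouping of two bipartite systems into one. -/
def regroup (ec : c ≃ c₁ × c₂) (ea : a ≃ a₁ × a₂) : c × a ≃ (c₁ × a₁) × (c₂ × a₂) :=
  (Equiv.prodCongr ec ea).trans (Equiv.prodProdProdComm _ _ _ _)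

/-- The regrouped product is affine in each factor separately, so two convex hull arguments reduce
to product states, where the factors are rearranged by party. -/
lemma kronecker_mem_separableStates (ec : c ≃ c₁ × c₂) (ea : a ≃ a₁ × a₂)
    {σ₁ : Matrix (c₁ × a₁) (c₁ × a₁) ℂ} (h₁ : σ₁ ∈ separableStates c₁ a₁)
    {σ₂ : Matrix (c₂ × a₂) (c₂ × a₂) ℂ} (h₂ : σ₂ ∈ separableStates c₂ a₂) :
    (σ₁ ⊗ₖ σ₂).submatrix (regroup ec ea) (regroup ec ea) ∈ separableStates c a := by
  have hconv : Convex ℝ (separableStates c a) := convex_convexHull ℝ _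
  have key : ∀ σ₂ ∈ separableStates c₂ a₂, separableStates c₁ a₁ ⊆
      {σ₁ | (σ₁ ⊗ₖ σ₂).submatrix (regroup ec ea) (regroup ec ea) ∈ separableStates c a} := by
    intro σ₂ h₂
    refine convexHull_min ?_ ?_
    · rintro _ ⟨α, β, hα, hβ, rfl⟩
      refine convexHull_min (t := {σ₂ | ((α ⊗ₖ β) ⊗ₖ σ₂).submatrix (regroup ec ea)
        (regroup ec ea) ∈ separableStates c a}) ?_ ?_ h₂
      · rintro _ ⟨α', β', hα', hβ', rfl⟩
        refine subset_convexHull ℝ _ ⟨(α ⊗ₖ α').submatrix ec ec, (β ⊗ₖ β').submatrix ea ea,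
          (hα.kronecker hα').submatrix ec, (hβ.kronecker hβ').submatrix ea, ?_⟩
        ext x y
        simp [regroup, mul_mul_mul_comm]
      · intro x hx y hy s t hs ht hst
        have := hconv hx hy hs ht hst
        rw [Set.mem_ofPred_eq]
        convert this using 1
        ext x y
        simp [mul_add, mul_left_comm]
    · intro x hx y hy s t hs ht hst
      have := hconv hx hy hs ht hst
      rw [Set.mem_ofPred_eq]
      convert this using 1
      ext x y
      simp [add_mul, mul_assoc]
  exact key σ₂ h₂ h₁

lemma posSemidef_tensorPower {X : Matrix ι ι ℂ} (hX : X.PosSemidef) (n : ℕ) :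
    (tensorPower X n).PosSemidef := by
  classical
  induction n with
  | zero =>
    have : tensorPower X 0 = 1 := by
      ext x y
      rw [Subsingleton.elim x y, Matrix.one_apply_eq]
      simp [tensorPower]
    rw [this]
    exact Matrix.PosSemidef.one
  | succ n ih =>
    have : tensorPower X (n + 1) = (X ⊗ₖ tensorPower X n).submatrix
        (fun x => (x 0, Fin.tail x)) (fun x => (x 0, Fin.tail x)) := by
      ext x y
      simp [tensorPower, Fin.prod_univ_succ, Fin.tail]
    rw [this]
    exact (hX.kronecker ih).submatrix _

lemma isState_bipartitePower [DecidableEq c] [DecidableEq a] {ρ : Matrix (c × a) (c × a) ℂ}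
    (h : IsState ρ) (n : ℕ) : IsState (bipartitePower ρ n) := by
  refine ⟨(posSemidef_tensorPower h.1 n).submatrix _, ?_⟩
  have h1 : (bipartitePower ρ n).trace = (tensorPower ρ n).trace :=
    Equiv.sum_comp (Equiv.arrowProdEquivProdArrow (Fin n) (fun _ => c) (fun _ => a)).symm
      fun i => tensorPower ρ n i i
  rw [h1]
  have h2 := Fintype.piFinset_univ (α := Fin n) (β := fun _ => c × a)
  have h3 := Finset.prod_univ_sum (fun _ : Fin n => (Finset.univ : Finset (c × a)))
    (fun _ x => ρ x x)
  rw [h2] at h3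
  have h4 : ∑ x, ρ x x = 1 := h.2
  simpa [h4, Matrix.trace, tensorPower] using h3.symm

/-- The maximally mixed state is a product state of full support. -/
lemma exists_separable_relativeEntropy_ne_top [DecidableEq c] [DecidableEq a]
    {ρ : Matrix (c × a) (c × a) ℂ} (h : IsState ρ) :
    ∃ σ ∈ separableStates c a, relativeEntropy ρ σ ≠ ⊤ := by
  obtain ⟨x⟩ := h.nonempty
  have hstate : ∀ (κ : Type) [Fintype κ] [DecidableEq κ] [Nonempty κ],
      IsState ((Fintype.card κ : ℝ)⁻¹ • (1 : Matrix κ κ ℂ)) := by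
    intro κ _ _ _
    refine ⟨Matrix.PosSemidef.one.smul (by positivity), ?_⟩
    rw [Matrix.trace_smul, Matrix.trace_one]
    simp
  have : Nonempty c := ⟨x.1⟩
  have : Nonempty a := ⟨x.2⟩
  refine ⟨_, subset_convexHull ℝ _ ⟨_, _, hstate c, hstate a, rfl⟩, ?_⟩
  rw [relativeEntropy, if_pos]
  · exact EReal.coe_ne_top _
  · intro v hv
    rw [Matrix.smul_kronecker, Matrix.kronecker_smul, Matrix.one_kronecker_one, smul_smul,
      Matrix.smul_mulVec, Matrix.one_mulVec, smul_eq_zero] at hv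
    rcases hv with hv | hv
    · simp at hv
    · rw [hv, Matrix.mulVec_zero]

end States

/-! ### The regularised relative entropy of entanglement -/

section Regularised

variable {c a : Type} [Fintype c] [DecidableEq c] [Fintype a] [DecidableEq a]

lemma relEntEntanglement_nonneg {ρ : Matrix (c × a) (c × a) ℂ} (h : IsState ρ) :
    0 ≤ relEntEntanglement ρ :=
  le_iInf₂ fun _ hσ => relativeEntropy_nonneg h (isState_of_mem_separableStates hσ)

lemma relEntEntanglement_ne_top {ρ : Matrix (c × a) (c × a) ℂ} (h : IsState ρ) :
    relEntEntanglement ρ ≠ ⊤ := by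
  obtain ⟨σ, hσ, hne⟩ := exists_separable_relativeEntropy_ne_top h
  exact ne_top_of_le_ne_top hne (iInf₂_le σ hσ)

lemma coe_toReal_relEntEntanglement {ρ : Matrix (c × a) (c × a) ℂ} (h : IsState ρ) :
    ((relEntEntanglement ρ).toReal : EReal) = relEntEntanglement ρ :=
  EReal.coe_toReal (relEntEntanglement_ne_top h)
    (ne_bot_of_le_ne_bot EReal.zero_ne_bot (relEntEntanglement_nonneg h))

lemma bipartitePower_add (ρ : Matrix (c × a) (c × a) ℂ) (m n : ℕ) :
    bipartitePower ρ (m + n) = (bipartitePower ρ m ⊗ₖ bipartitePower ρ n).submatrix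
      (regroup (Fin.appendEquiv m n).symm (Fin.appendEquiv m n).symm)
      (regroup (Fin.appendEquiv m n).symm (Fin.appendEquiv m n).symm) := by
  ext x y
  simp [bipartitePower, tensorPower, Fin.prod_univ_add, regroup, Fin.appendEquiv]

/-- The product of nearly optimal separable states for the two blocks is a separable candidate for
the joint block. -/
lemma relEntEntanglement_bipartitePower_add_le {ρ : Matrix (c × a) (c × a) ℂ} (h : IsState ρ)
    (m n : ℕ) : relEntEntanglement (bipartitePower ρ (m + n)) ≤
      relEntEntanglement (bipartitePower ρ m) + relEntEntanglement (bipartitePower ρ n) := by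
  have hm := isState_bipartitePower h m
  have hn := isState_bipartitePower h n
  rw [← coe_toReal_relEntEntanglement hm, ← coe_toReal_relEntEntanglement hn]
  refine EReal.le_of_forall_lt_iff_le.1 fun z hz => ?_
  rw [← EReal.coe_add, EReal.coe_lt_coe_iff] at hz
  -- Half of the slack is granted to each block.
  set δ := (z - ((relEntEntanglement (bipartitePower ρ m)).toReal +
    (relEntEntanglement (bipartitePower ρ n)).toReal)) / 2 with hδ
  have hδ0 : 0 < δ := by rw [hδ]; linarith
  have hex : ∀ k, ∃ σ ∈ separableStates (Fin k → c) (Fin k → a),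
      relativeEntropy (bipartitePower ρ k) σ <
        (((relEntEntanglement (bipartitePower ρ k)).toReal + δ : ℝ) : EReal) := by
    intro k
    have : relEntEntanglement (bipartitePower ρ k) <
        (((relEntEntanglement (bipartitePower ρ k)).toReal + δ : ℝ) : EReal) := by
      conv_lhs => rw [← coe_toReal_relEntEntanglement (isState_bipartitePower h k)]
      rw [EReal.coe_lt_coe_iff]
      linarith
    simpa only [relEntEntanglement, iInf_lt_iff, exists_prop] using this
  obtain ⟨σ₁, hσ₁, h₁⟩ := hex m
  obtain ⟨σ₂, hσ₂, h₂⟩ := hex n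
  have s₁ := isState_of_mem_separableStates hσ₁
  have s₂ := isState_of_mem_separableStates hσ₂
  refine (iInf₂_le _ (kronecker_mem_separableStates (Fin.appendEquiv m n).symm
    (Fin.appendEquiv m n).symm hσ₁ hσ₂)).trans ?_
  rw [bipartitePower_add, relativeEntropy_submatrix _ _ (hm.kronecker hn).1.isHermitian
    (s₁.kronecker s₂).1.isHermitian]
  refine (relativeEntropy_kronecker_le hm s₁ hn s₂).trans ?_
  refine (add_le_add h₁.le h₂.le).trans ?_
  rw [← EReal.coe_add, EReal.coe_le_coe_iff]
  linarith

lemma relEntRate_eq {ρ : Matrix (c × a) (c × a) ℂ} (h : IsState ρ) (n : ℕ) :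
    relEntRate ρ n = (((relEntEntanglement (bipartitePower ρ n)).toReal / n : ℝ) : EReal) := by
  rw [EReal.coe_div, coe_toReal_relEntEntanglement (isState_bipartitePower h n)]
  rfl

/-- Fekete's lemma, applied to the real values of `E_R`, which are finite and nonnegative. -/
lemma exists_tendsto_relEntRate {ρ : Matrix (c × a) (c × a) ℂ} (h : IsState ρ) :
    ∃ L : ℝ, 0 ≤ L ∧
      Tendsto (fun n : ℕ => (relEntEntanglement (bipartitePower ρ n)).toReal / n) atTop (𝓝 L) ∧
      Tendsto (relEntRate ρ) atTop (𝓝 (L : EReal)) ∧ regRelEntEntanglement ρ = L := by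
  have hsub : Subadditive fun n : ℕ => (relEntEntanglement (bipartitePower ρ n)).toReal := by
    intro m n
    have := relEntEntanglement_bipartitePower_add_le h m n
    rw [← coe_toReal_relEntEntanglement (isState_bipartitePower h m),
      ← coe_toReal_relEntEntanglement (isState_bipartitePower h n),
      ← coe_toReal_relEntEntanglement (isState_bipartitePower h (m + n)), ← EReal.coe_add,
      EReal.coe_le_coe_iff] at this
    exact this
  have hnn : ∀ n : ℕ, 0 ≤ (relEntEntanglement (bipartitePower ρ n)).toReal / n := fun n =>
    div_nonneg (EReal.toReal_nonneg (relEntEntanglement_nonneg (isState_bipartitePower h n)))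
      (Nat.cast_nonneg n)
  have hlim := hsub.tendsto_lim ⟨0, by rintro _ ⟨n, rfl⟩; exact hnn n⟩
  have hlim' : Tendsto (relEntRate ρ) atTop (𝓝 (hsub.lim : EReal)) := by
    refine ((continuous_coe_real_ereal.tendsto _).comp hlim).congr fun n => ?_
    exact (relEntRate_eq h n).symm
  exact ⟨hsub.lim, ge_of_tendsto' hlim hnn, hlim, hlim', hlim'.limsup_eq⟩

end Regularised

/-! ### Properties of LOCC protocols -/

section Parties

variable {a c b a₁ c₁ b₁ : Type}

/-- The partial transpose with respect to Charlie's system. -/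
def transposeCharlie (X : Matrix (a × c × b) (a × c × b) ℂ) :
    Matrix (a × c × b) (a × c × b) ℂ :=
  Matrix.of fun x y => X (x.1, y.2.1, x.2.2) (y.1, x.2.1, y.2.2)

/-- `Y ⊗ Z` for `Y` held jointly by Alice and Charlie, and `Z` held by Bob. -/
def tensorBob (Y : Matrix (a × c) (a × c) ℂ) (Z : Matrix b b ℂ) :
    Matrix (a × c × b) (a × c × b) ℂ :=
  (Y ⊗ₖ Z).submatrix (Equiv.prodAssoc a c b).symm (Equiv.prodAssoc a c b).symm

lemma transposeCharlie_sum {ι : Type} (s : Finset ι)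
    (X : ι → Matrix (a × c × b) (a × c × b) ℂ) :
    transposeCharlie (∑ i ∈ s, X i) = ∑ i ∈ s, transposeCharlie (X i) := by
  ext x y
  simp [transposeCharlie, Matrix.sum_apply]

/-- A partial trace is blind to a transposition of the traced system; positivity of what Alice and
Bob receive may therefore be checked after transposing Charlie. -/
lemma traceCharlie_transposeCharlie [Fintype c] (X : Matrix (a × c × b) (a × c × b) ℂ) :
    traceCharlie (transposeCharlie X) = traceCharlie X := rfl

lemma traceCharlie_sum [Fintype c] {ι : Type} (s : Finset ι)
    (X : ι → Matrix (a × c × b) (a × c × b) ℂ) :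
    traceCharlie (∑ i ∈ s, X i) = ∑ i ∈ s, traceCharlie (X i) := by
  ext x y
  simp only [traceCharlie, Matrix.sum_apply, Matrix.of_apply]
  exact Finset.sum_comm

lemma traceCharlie_add [Fintype c] (X Y : Matrix (a × c × b) (a × c × b) ℂ) :
    traceCharlie (X + Y) = traceCharlie X + traceCharlie Y := by
  ext x y
  simp [traceCharlie, Finset.sum_add_distrib]

lemma traceCharlie_smul [Fintype c] (z : ℂ) (X : Matrix (a × c × b) (a × c × b) ℂ) :
    traceCharlie (z • X) = z • traceCharlie X := by
  ext x y
  simp [traceCharlie, Finset.mul_sum]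

lemma posSemidef_traceCharlie [Fintype c] {X : Matrix (a × c × b) (a × c × b) ℂ}
    (h : X.PosSemidef) : (traceCharlie X).PosSemidef := by
  have : traceCharlie X = ∑ k, X.submatrix (fun x : a × b => (x.1, k, x.2)) (fun x => (x.1, k, x.2)) := by
    ext x y
    simp [traceCharlie, Matrix.sum_apply]
  rw [this]
  exact Matrix.posSemidef_sum _ fun k _ => h.submatrix _

lemma trace_traceCharlie [Fintype a] [Fintype c] [Fintype b]
    (X : Matrix (a × c × b) (a × c × b) ℂ) : (traceCharlie X).trace = X.trace := by
  simp only [Matrix.trace, Matrix.diag_apply, traceCharlie, Matrix.of_apply,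
    Fintype.sum_prod_type]
  exact Finset.sum_congr rfl fun i _ => Finset.sum_comm

lemma traceCharlie_tensorBob [Fintype c] (Y : Matrix (a × c) (a × c) ℂ) (Z : Matrix b b ℂ) :
    traceCharlie (tensorBob Y Z) =
      (∑ k, Y.submatrix (fun x => (x, k)) (fun x => (x, k))) ⊗ₖ Z := by
  ext x y
  simp [traceCharlie, tensorBob, Matrix.sum_apply, Finset.sum_mul]

variable [Fintype a] [Fintype c] [Fintype b] [DecidableEq a] [DecidableEq c] [DecidableEq b]

lemma actAlice_apply (L : Matrix a₁ a ℂ) (X : Matrix (a × c × b) (a × c × b) ℂ)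
    (x y : a₁ × c × b) :
    actAlice L X x y = ∑ v, ∑ u, L x.1 u * X (u, x.2) (v, y.2) * star (L y.1 v) := by
  obtain ⟨x₁, x₂, x₃⟩ := x
  obtain ⟨y₁, y₂, y₃⟩ := y
  simp [actAlice, Matrix.mul_apply, Fintype.sum_prod_type, Matrix.one_apply, Finset.sum_mul,
    apply_ite (starRingEnd ℂ)]

lemma actCharlie_apply (L : Matrix c₁ c ℂ) (X : Matrix (a × c × b) (a × c × b) ℂ)
    (x y : a × c₁ × b) :
    actCharlie L X x y =
      ∑ v, ∑ u, L x.2.1 u * X (x.1, u, x.2.2) (y.1, v, y.2.2) * star (L y.2.1 v) := by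
  obtain ⟨x₁, x₂, x₃⟩ := x
  obtain ⟨y₁, y₂, y₃⟩ := y
  simp [actCharlie, Matrix.mul_apply, Fintype.sum_prod_type, Matrix.one_apply, Finset.sum_mul,
    apply_ite (starRingEnd ℂ)]

lemma actBob_apply (L : Matrix b₁ b ℂ) (X : Matrix (a × c × b) (a × c × b) ℂ)
    (x y : a × c × b₁) :
    actBob L X x y =
      ∑ v, ∑ u, L x.2.2 u * X (x.1, x.2.1, u) (y.1, y.2.1, v) * star (L y.2.2 v) := by
  obtain ⟨x₁, x₂, x₃⟩ := x
  obtain ⟨y₁, y₂, y₃⟩ := y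
  simp [actBob, Matrix.mul_apply, Fintype.sum_prod_type, Matrix.one_apply, Finset.sum_mul,
    apply_ite (starRingEnd ℂ)]

lemma transposeCharlie_actAlice (L : Matrix a₁ a ℂ) (X : Matrix (a × c × b) (a × c × b) ℂ) :
    transposeCharlie (actAlice L X) = actAlice L (transposeCharlie X) := by
  ext x y
  simp [transposeCharlie, actAlice_apply]

lemma transposeCharlie_actBob (L : Matrix b₁ b ℂ) (X : Matrix (a × c × b) (a × c × b) ℂ) :
    transposeCharlie (actBob L X) = actBob L (transposeCharlie X) := by
  ext x y
  simp [transposeCharlie, actBob_apply]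

/-- Transposing `L X L†` on Charlie's side gives `L̄ Xᵀ L̄†`: the conjugated Kraus operator acts on
the transposed operator, so complete positivity persists. -/
lemma transposeCharlie_actCharlie (L : Matrix c₁ c ℂ) (X : Matrix (a × c × b) (a × c × b) ℂ) :
    transposeCharlie (actCharlie L X) = actCharlie (L.map star) (transposeCharlie X) := by
  ext x y
  simp only [transposeCharlie, actCharlie_apply, Matrix.of_apply, Matrix.map_apply, star_star]
  rw [Finset.sum_comm]
  refine Finset.sum_congr rfl fun u _ => Finset.sum_congr rfl fun v _ => ?_
  ring

/-- With its two analogues below: each local operation acts inside one factor of the cut Alice and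
Charlie versus Bob, so a product stays a product along every branch of a protocol. -/
lemma actAlice_tensorBob (L : Matrix a₁ a ℂ) (Y : Matrix (a × c) (a × c) ℂ) (Z : Matrix b b ℂ) :
    actAlice L (tensorBob Y Z) =
      tensorBob ((L ⊗ₖ (1 : Matrix c c ℂ)) * Y * (L ⊗ₖ (1 : Matrix c c ℂ))ᴴ) Z := by
  have h : L ⊗ₖ ((1 : Matrix c c ℂ) ⊗ₖ (1 : Matrix b b ℂ)) =
      ((L ⊗ₖ (1 : Matrix c c ℂ)) ⊗ₖ (1 : Matrix b b ℂ)).submatrix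
        (Equiv.prodAssoc a₁ c b).symm (Equiv.prodAssoc a c b).symm := by
    ext x y
    simp only [Matrix.kroneckerMap_apply, Matrix.submatrix_apply, Equiv.prodAssoc_symm_apply,
      mul_assoc]
  rw [actAlice, tensorBob, h, Matrix.conjTranspose_submatrix, Matrix.submatrix_mul_equiv,
    Matrix.submatrix_mul_equiv, Matrix.conjTranspose_kronecker, ← Matrix.mul_kronecker_mul,
    ← Matrix.mul_kronecker_mul]
  simp [tensorBob]

lemma actCharlie_tensorBob (L : Matrix c₁ c ℂ) (Y : Matrix (a × c) (a × c) ℂ)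
    (Z : Matrix b b ℂ) :
    actCharlie L (tensorBob Y Z) =
      tensorBob (((1 : Matrix a a ℂ) ⊗ₖ L) * Y * ((1 : Matrix a a ℂ) ⊗ₖ L)ᴴ) Z := by
  have h : (1 : Matrix a a ℂ) ⊗ₖ (L ⊗ₖ (1 : Matrix b b ℂ)) =
      (((1 : Matrix a a ℂ) ⊗ₖ L) ⊗ₖ (1 : Matrix b b ℂ)).submatrix
        (Equiv.prodAssoc a c₁ b).symm (Equiv.prodAssoc a c b).symm := by
    ext x y
    simp only [Matrix.kroneckerMap_apply, Matrix.submatrix_apply, Equiv.prodAssoc_symm_apply,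
      mul_assoc]
  rw [actCharlie, tensorBob, h, Matrix.conjTranspose_submatrix, Matrix.submatrix_mul_equiv,
    Matrix.submatrix_mul_equiv, Matrix.conjTranspose_kronecker, ← Matrix.mul_kronecker_mul,
    ← Matrix.mul_kronecker_mul]
  simp [tensorBob]

lemma actBob_tensorBob (L : Matrix b₁ b ℂ) (Y : Matrix (a × c) (a × c) ℂ) (Z : Matrix b b ℂ) :
    actBob L (tensorBob Y Z) = tensorBob Y (L * Z * Lᴴ) := by
  have h : (1 : Matrix a a ℂ) ⊗ₖ ((1 : Matrix c c ℂ) ⊗ₖ L) =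
      ((1 : Matrix (a × c) (a × c) ℂ) ⊗ₖ L).submatrix
        (Equiv.prodAssoc a c b₁).symm (Equiv.prodAssoc a c b).symm := by
    rw [← Matrix.one_kronecker_one]
    ext x y
    simp only [Matrix.kroneckerMap_apply, Matrix.submatrix_apply, Equiv.prodAssoc_symm_apply,
      mul_assoc]
  rw [actBob, tensorBob, h, Matrix.conjTranspose_submatrix, Matrix.submatrix_mul_equiv,
    Matrix.submatrix_mul_equiv, Matrix.conjTranspose_kronecker, ← Matrix.mul_kronecker_mul,
    ← Matrix.mul_kronecker_mul]
  simp [tensorBob]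

lemma trace_sum_conj {x y : Type} [Fintype x] [DecidableEq x] [Fintype y] {r s : ℕ}
    {K : Fin r → Fin s → Matrix y x ℂ} (hK : ∑ i, ∑ j, (K i j)ᴴ * K i j = 1) (X : Matrix x x ℂ) :
    ∑ i, (∑ j, K i j * X * (K i j)ᴴ).trace = X.trace := by
  calc _ = ((∑ i, ∑ j, (K i j)ᴴ * K i j) * X).trace := by
        simp only [Matrix.trace_sum, Finset.sum_mul]
        refine Finset.sum_congr rfl fun i _ => Finset.sum_congr rfl fun j _ => ?_
        rw [Matrix.trace_mul_comm, ← Matrix.mul_assoc]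
    _ = _ := by rw [hK, Matrix.one_mul]

lemma IsInstrument.kronecker_one {x y z : Type} [Fintype y] [DecidableEq x] [Fintype z]
    [DecidableEq z] {r s : ℕ} {K : Fin r → Fin s → Matrix y x ℂ} (hK : IsInstrument K) :
    IsInstrument fun i j => K i j ⊗ₖ (1 : Matrix z z ℂ) := by
  simp only [IsInstrument, Matrix.conjTranspose_kronecker, ← Matrix.mul_kronecker_mul]
  have h : ∀ f : Fin r → Fin s → Matrix x x ℂ, ∑ i, ∑ j, f i j ⊗ₖ ((1 : Matrix z z ℂ)ᴴ * 1) =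
      (∑ i, ∑ j, f i j) ⊗ₖ (1 : Matrix z z ℂ) := by
    intro f
    ext u v
    simp [Matrix.sum_apply, Finset.sum_mul]
  rw [h, hK, Matrix.one_kronecker_one]

lemma IsInstrument.one_kronecker {x y z : Type} [Fintype y] [DecidableEq x] [Fintype z]
    [DecidableEq z] {r s : ℕ} {K : Fin r → Fin s → Matrix y x ℂ} (hK : IsInstrument K) :
    IsInstrument fun i j => (1 : Matrix z z ℂ) ⊗ₖ K i j := by
  simp only [IsInstrument, Matrix.conjTranspose_kronecker, ← Matrix.mul_kronecker_mul]
  have h : ∀ f : Fin r → Fin s → Matrix x x ℂ, ∑ i, ∑ j, ((1 : Matrix z z ℂ)ᴴ * 1) ⊗ₖ f i j =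
      (1 : Matrix z z ℂ) ⊗ₖ (∑ i, ∑ j, f i j) := by
    intro f
    ext u v
    simp [Matrix.sum_apply, Finset.mul_sum]
  rw [h, hK, Matrix.one_kronecker_one]

end Parties

/-! ### Inductions over LOCC protocols -/

section Protocols

variable {a' c' b' a c b : Type}
  {Λ : Matrix (a × c × b) (a × c × b) ℂ → Matrix (a' × c' × b') (a' × c' × b') ℂ}

lemma IsLOCC.map_add (h : IsLOCC Λ) : ∀ X Y, Λ (X + Y) = Λ X + Λ Y := by
  induction h with
  | done => intro X Y; rfl
  | alice K hK Λ hΛ ih =>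
    intro X Y
    simp only [actAlice, Matrix.mul_add, Matrix.add_mul, Finset.sum_add_distrib, ih]
  | charlie K hK Λ hΛ ih =>
    intro X Y
    simp only [actCharlie, Matrix.mul_add, Matrix.add_mul, Finset.sum_add_distrib, ih]
  | bob K hK Λ hΛ ih =>
    intro X Y
    simp only [actBob, Matrix.mul_add, Matrix.add_mul, Finset.sum_add_distrib, ih]

lemma IsLOCC.map_smul (h : IsLOCC Λ) : ∀ (z : ℂ) X, Λ (z • X) = z • Λ X := by
  induction h with
  | done => intro z X; rfl
  | alice K hK Λ hΛ ih =>
    intro z X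
    simp only [actAlice, Matrix.mul_smul, Matrix.smul_mul, ← Finset.smul_sum, ih]
  | charlie K hK Λ hΛ ih =>
    intro z X
    simp only [actCharlie, Matrix.mul_smul, Matrix.smul_mul, ← Finset.smul_sum, ih]
  | bob K hK Λ hΛ ih =>
    intro z X
    simp only [actBob, Matrix.mul_smul, Matrix.smul_mul, ← Finset.smul_sum, ih]

lemma IsLOCC.trace_map [fa' : Fintype a'] [fc' : Fintype c'] [fb' : Fintype b'] (h : IsLOCC Λ) :
    ∀ [Fintype a] [Fintype c] [Fintype b] X, (Λ X).trace = X.trace := by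
  induction h with
  | done =>
    intro fa fc fb X
    -- Each protocol node carries its own `Fintype` instances; they are identified with the ambient
    -- ones, here and in the other cases.
    obtain rfl := Subsingleton.elim fa' fa
    obtain rfl := Subsingleton.elim fc' fc
    obtain rfl := Subsingleton.elim fb' fb
    rfl
  | @alice a c b a₁ fa fc fb fa₁ da dc db r s K hK Λ hΛ ih =>
    intro ga gc gb X
    obtain rfl := Subsingleton.elim fa ga
    obtain rfl := Subsingleton.elim fc gc
    obtain rfl := Subsingleton.elim fb gb
    rw [Matrix.trace_sum]
    simp only [ih]
    have h : IsInstrument fun i j => K i j ⊗ₖ ((1 : Matrix c c ℂ) ⊗ₖ (1 : Matrix b b ℂ)) := by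
      rw [Matrix.one_kronecker_one]
      exact hK.kronecker_one
    exact trace_sum_conj h X
  | @charlie a c b c₁ fa fc fb fc₁ da dc db r s K hK Λ hΛ ih =>
    intro ga gc gb X
    obtain rfl := Subsingleton.elim fa ga
    obtain rfl := Subsingleton.elim fc gc
    obtain rfl := Subsingleton.elim fb gb
    rw [Matrix.trace_sum]
    simp only [ih]
    exact trace_sum_conj hK.kronecker_one.one_kronecker X
  | @bob a c b b₁ fa fc fb fb₁ da dc db r s K hK Λ hΛ ih =>
    intro ga gc gb X
    obtain rfl := Subsingleton.elim fa ga
    obtain rfl := Subsingleton.elim fc gc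
    obtain rfl := Subsingleton.elim fb gb
    rw [Matrix.trace_sum]
    simp only [ih]
    exact trace_sum_conj hK.one_kronecker.one_kronecker X

/-- Conjugating Charlie's Kraus operators moves the transposition through each round. Positivity of
`X` itself is not assumed, which is essential for the inputs used later. -/
lemma IsLOCC.posSemidef_transposeCharlie (h : IsLOCC Λ) :
    ∀ X, (transposeCharlie X).PosSemidef → (transposeCharlie (Λ X)).PosSemidef := by
  induction h with
  | done => intro X hX; exact hX
  | alice K hK Λ hΛ ih =>
    intro X hX
    rw [transposeCharlie_sum]
    refine Matrix.posSemidef_sum _ fun i _ => ih i _ ?_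
    rw [transposeCharlie_sum]
    refine Matrix.posSemidef_sum _ fun j _ => ?_
    rw [transposeCharlie_actAlice]
    exact hX.mul_mul_conjTranspose_same _
  | charlie K hK Λ hΛ ih =>
    intro X hX
    rw [transposeCharlie_sum]
    refine Matrix.posSemidef_sum _ fun i _ => ih i _ ?_
    rw [transposeCharlie_sum]
    refine Matrix.posSemidef_sum _ fun j _ => ?_
    rw [transposeCharlie_actCharlie]
    exact hX.mul_mul_conjTranspose_same _
  | bob K hK Λ hΛ ih =>
    intro X hX
    rw [transposeCharlie_sum]
    refine Matrix.posSemidef_sum _ fun i _ => ih i _ ?_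
    rw [transposeCharlie_sum]
    refine Matrix.posSemidef_sum _ fun j _ => ?_
    rw [transposeCharlie_actBob]
    exact hX.mul_mul_conjTranspose_same _

lemma tensorBob_sum_left {ι : Type} (s : Finset ι) (Y : ι → Matrix (a × c) (a × c) ℂ)
    (Z : Matrix b b ℂ) : ∑ i ∈ s, tensorBob (Y i) Z = tensorBob (∑ i ∈ s, Y i) Z := by
  ext x y
  simp [tensorBob, Matrix.sum_apply, Finset.sum_mul]

lemma tensorBob_sum_right {ι : Type} (s : Finset ι) (Y : Matrix (a × c) (a × c) ℂ)
    (Z : ι → Matrix b b ℂ) : ∑ i ∈ s, tensorBob Y (Z i) = tensorBob Y (∑ i ∈ s, Z i) := by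
  ext x y
  simp [tensorBob, Matrix.sum_apply, Finset.mul_sum]

/-- A bound on the expectation of an observable in product states of Alice and Bob is inherited by
the outputs of LOCC protocols on product states of Alice and Charlie versus Bob. -/
lemma IsLOCC.trace_mul_tensorBob_le [fa' : Fintype a'] [fc' : Fintype c'] [fb' : Fintype b']
    {P : Matrix (a' × b') (a' × b') ℂ} {r : ℂ}
    (hP : ∀ (Y : Matrix a' a' ℂ) (Z : Matrix b' b' ℂ), Y.PosSemidef → Z.PosSemidef →
      (P * (Y ⊗ₖ Z)).trace ≤ r * (Y.trace * Z.trace)) (h : IsLOCC Λ) :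
    ∀ [Fintype a] [Fintype c] [Fintype b] (Y : Matrix (a × c) (a × c) ℂ) (Z : Matrix b b ℂ),
      Y.PosSemidef → Z.PosSemidef →
        (P * traceCharlie (Λ (tensorBob Y Z))).trace ≤ r * (Y.trace * Z.trace) := by
  induction h with
  | done =>
    intro fa fc fb Y Z hY hZ
    obtain rfl := Subsingleton.elim fa' fa
    obtain rfl := Subsingleton.elim fc' fc
    obtain rfl := Subsingleton.elim fb' fb
    rw [traceCharlie_tensorBob]
    refine (hP _ Z (Matrix.posSemidef_sum _ fun k _ => hY.submatrix _) hZ).trans_eq ?_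
    congr 2
    simp only [Matrix.trace, Matrix.diag_apply, Matrix.sum_apply, Matrix.submatrix_apply,
      Fintype.sum_prod_type]
  | @alice a c b a₁ fa fc fb fa₁ da dc db k s K hK Λ hΛ ih =>
    intro ga gc gb Y Z hY hZ
    obtain rfl := Subsingleton.elim fa ga
    obtain rfl := Subsingleton.elim fc gc
    obtain rfl := Subsingleton.elim fb gb
    -- Completeness of the instrument splits the trace of `Y` over the outcomes, so the bounds for
    -- the branches add up to the claim.
    rw [traceCharlie_sum, Finset.mul_sum, Matrix.trace_sum,
      ← trace_sum_conj (hK.kronecker_one (z := c)) Y, Finset.sum_mul, Finset.mul_sum]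
    refine Finset.sum_le_sum fun i _ => ?_
    simp only [actAlice_tensorBob, tensorBob_sum_left]
    exact ih i _ _ (Matrix.posSemidef_sum _ fun j _ => hY.mul_mul_conjTranspose_same _) hZ
  | @charlie a c b c₁ fa fc fb fc₁ da dc db k s K hK Λ hΛ ih =>
    intro ga gc gb Y Z hY hZ
    obtain rfl := Subsingleton.elim fa ga
    obtain rfl := Subsingleton.elim fc gc
    obtain rfl := Subsingleton.elim fb gb
    rw [traceCharlie_sum, Finset.mul_sum, Matrix.trace_sum,
      ← trace_sum_conj (hK.one_kronecker (z := a)) Y, Finset.sum_mul, Finset.mul_sum]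
    refine Finset.sum_le_sum fun i _ => ?_
    simp only [actCharlie_tensorBob, tensorBob_sum_left]
    exact ih i _ _ (Matrix.posSemidef_sum _ fun j _ => hY.mul_mul_conjTranspose_same _) hZ
  | @bob a c b b₁ fa fc fb fb₁ da dc db k s K hK Λ hΛ ih =>
    intro ga gc gb Y Z hY hZ
    obtain rfl := Subsingleton.elim fa ga
    obtain rfl := Subsingleton.elim fc gc
    obtain rfl := Subsingleton.elim fb gb
    rw [traceCharlie_sum, Finset.mul_sum, Matrix.trace_sum, ← trace_sum_conj hK Z,
      Finset.mul_sum, Finset.mul_sum]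
    refine Finset.sum_le_sum fun i _ => ?_
    simp only [actBob_tensorBob, tensorBob_sum_right]
    exact ih i _ _ hY (Matrix.posSemidef_sum _ fun j _ => hZ.mul_mul_conjTranspose_same _)

end Protocols

/-! ### Trace norm -/

section TraceNorm

variable {ι : Type} [Fintype ι] [DecidableEq ι]

lemma posSemidef_of_projection {P : Matrix ι ι ℂ} (hP : P.IsHermitian) (hP' : P * P = P) :
    P.PosSemidef := by
  rw [← hP']
  nth_rw 1 [← hP.eq]
  exact Matrix.posSemidef_conjTranspose_mul_self P

lemma posSemidef_one_sub_of_projection {P : Matrix ι ι ℂ} (hP : P.IsHermitian)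
    (hP' : P * P = P) : (1 - P).PosSemidef :=
  posSemidef_of_projection (Matrix.isHermitian_one.sub hP) (by
    rw [sub_mul, mul_sub, mul_sub, hP']; simp)

lemma conjTranspose_mul_self_apply_diag {κ : Type} (A : Matrix ι κ ℂ) (j : κ) :
    (Aᴴ * A) j j = ((∑ i, ‖A i j‖ ^ 2 : ℝ) : ℂ) := by
  rw [Matrix.mul_apply, Complex.ofReal_sum]
  refine Finset.sum_congr rfl fun i _ => ?_
  rw [Matrix.conjTranspose_apply, mul_comm, ← starRingEnd_apply, Complex.mul_conj,
    Complex.normSq_eq_norm_sq]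

/-- In an eigenbasis `V` of `Xᴴ * X` the columns of `X * V` have the singular values of `X` as
norms, and those of `P * V` have norm at most one; apply Cauchy–Schwarz column by column. -/
lemma norm_trace_mul_le_traceNorm {P : Matrix ι ι ℂ} (hP : P.IsHermitian) (hP' : P * P = P)
    (X : Matrix ι ι ℂ) : ‖(P * X).trace‖ ≤ traceNorm X := by
  have hX := Matrix.isHermitian_conjTranspose_mul_self X
  have hV := diagonalizes_eigenvectorUnitary hX
  set V := (hX.eigenvectorUnitary : Matrix ι ι ℂ)
  have h1 : (P * X).trace = ∑ j, ∑ i, star ((P * V) i j) * (X * V) i j := by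
    calc (P * X).trace = (P * X * (V * Vᴴ)).trace := by rw [hV.mul_conjTranspose, Matrix.mul_one]
      _ = ((P * V)ᴴ * (X * V)).trace := by
        rw [← Matrix.mul_assoc, Matrix.trace_mul_comm, Matrix.conjTranspose_mul, hP.eq]
        simp only [Matrix.mul_assoc]
      _ = _ := by
        refine Finset.sum_congr rfl fun j _ => ?_
        rw [Matrix.diag_apply, Matrix.mul_apply]
        rfl
  have hb : ∀ j, ∑ i, ‖(X * V) i j‖ ^ 2 = hX.eigenvalues j := by
    intro j
    have h2 := conjTranspose_mul_self_apply_diag (X * V) j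
    have h3 : (X * V)ᴴ * (X * V) = Matrix.diagonal fun k => (hX.eigenvalues k : ℂ) := by
      calc (X * V)ᴴ * (X * V) = Vᴴ * (Xᴴ * X) * V := by
            rw [Matrix.conjTranspose_mul]; simp only [Matrix.mul_assoc]
        _ = (Vᴴ * V) * Matrix.diagonal (fun k => (hX.eigenvalues k : ℂ)) * (Vᴴ * V) := by
            conv_lhs => rw [hV.eq]
            simp only [Matrix.mul_assoc]
        _ = _ := by rw [hV.conjTranspose_mul, Matrix.one_mul, Matrix.mul_one]
    rw [h3, Matrix.diagonal_apply_eq] at h2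
    exact_mod_cast h2.symm
  have ha : ∀ j, ∑ i, ‖(P * V) i j‖ ^ 2 ≤ 1 := by
    intro j
    have h2 := conjTranspose_mul_self_apply_diag (P * V) j
    have h3 := ((posSemidef_one_sub_of_projection hP hP').conjTranspose_mul_mul_same V).diag_nonneg
      (i := j)
    have h4 : Vᴴ * (1 - P) * V = 1 - (P * V)ᴴ * (P * V) := by
      rw [Matrix.mul_sub, Matrix.sub_mul, Matrix.mul_one, hV.conjTranspose_mul,
        Matrix.conjTranspose_mul, hP.eq, Matrix.mul_assoc Vᴴ P (P * V), ← Matrix.mul_assoc P P V,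
        hP', ← Matrix.mul_assoc]
    rw [h4, Matrix.sub_apply, Matrix.one_apply_eq, h2, sub_nonneg] at h3
    exact_mod_cast h3
  rw [h1, traceNorm]
  refine (norm_sum_le _ _).trans (Finset.sum_le_sum fun j _ => ?_)
  refine (norm_sum_le _ _).trans ?_
  simp only [norm_mul, norm_star]
  refine (Real.sum_mul_le_sqrt_mul_sqrt _ _ _).trans ?_
  rw [hb]
  exact mul_le_of_le_one_left (Real.sqrt_nonneg _) (Real.sqrt_le_one.2 (ha j))

end TraceNorm

/-! ### Private states -/

section PrivateStates

variable {k p q : ℕ}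

lemma isHermitian_maxEntangled : (maxEntangled k).IsHermitian := by
  ext x y
  simp only [Matrix.conjTranspose_apply, maxEntangled, Matrix.of_apply]
  by_cases h : y.1 = y.2 ∧ x.1 = x.2
  · rw [if_pos h, if_pos h.symm]
    simp
  · rw [if_neg h, if_neg fun h' => h h'.symm, star_zero]

lemma maxEntangled_mul_self (hk : k ≠ 0) : maxEntangled k * maxEntangled k = maxEntangled k := by
  have hk' : (k : ℂ) ≠ 0 := Nat.cast_ne_zero.2 hk
  ext ⟨x₁, x₂⟩ ⟨y₁, y₂⟩
  rw [Matrix.mul_apply, Fintype.sum_prod_type]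
  by_cases hx : x₁ = x₂ <;> by_cases hy : y₁ = y₂ <;> simp [maxEntangled, hx, hy, hk']

lemma trace_maxEntangled (hk : k ≠ 0) : (maxEntangled k).trace = 1 := by
  have hk' : (k : ℂ) ≠ 0 := Nat.cast_ne_zero.2 hk
  simp [Matrix.trace, maxEntangled, Fintype.sum_prod_type, hk']

variable {U : Fin k × Fin k → Matrix (Fin p × Fin q) (Fin p × Fin q) ℂ}

lemma twist_mul_twist (V : Fin k × Fin k → Matrix (Fin p × Fin q) (Fin p × Fin q) ℂ) :
    (twist U)ᴴ * twist V = twist fun x => (U x)ᴴ * V x := by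
  ext ⟨x, s⟩ ⟨y, t⟩
  rw [Matrix.mul_apply, Fintype.sum_prod_type, Finset.sum_eq_single x]
  · by_cases h : x = y
    · simp [twist, h, Matrix.mul_apply]
    · simp [twist, h]
  · intro z _ hz
    simp [twist, hz]
  · simp

lemma conjTranspose_twist_mul (hU : ∀ x, U x ∈ Matrix.unitaryGroup (Fin p × Fin q) ℂ) :
    (twist U)ᴴ * twist U = 1 := by
  rw [twist_mul_twist]
  ext ⟨x, s⟩ ⟨y, t⟩
  have h : (U x)ᴴ * U x = 1 := Matrix.mem_unitaryGroup_iff'.1 (hU x)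
  by_cases hxy : x = y
  · subst hxy
    simp [twist, h, Matrix.one_apply]
  · simp [twist, hxy]

/-- The projector onto the twisted maximally entangled states with key dimension `k`. -/
noncomputable def keyProjector (U : Fin k × Fin k → Matrix (Fin p × Fin q) (Fin p × Fin q) ℂ) :
    Matrix ((Fin k × Fin p) × (Fin k × Fin q)) ((Fin k × Fin p) × (Fin k × Fin q)) ℂ :=
  (twist U * (maxEntangled k ⊗ₖ (1 : Matrix (Fin p × Fin q) (Fin p × Fin q) ℂ)) *
    (twist U)ᴴ).submatrix (Equiv.prodProdProdComm _ _ _ _) (Equiv.prodProdProdComm _ _ _ _)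

lemma isHermitian_keyProjector : (keyProjector U).IsHermitian := by
  refine Matrix.IsHermitian.submatrix ?_ _
  refine Matrix.isHermitian_mul_mul_conjTranspose _ ?_
  rw [Matrix.IsHermitian, Matrix.conjTranspose_kronecker, isHermitian_maxEntangled.eq,
    Matrix.conjTranspose_one]

lemma twisted_mul_twisted (hU : ∀ x, U x ∈ Matrix.unitaryGroup (Fin p × Fin q) ℂ)
    (A B : Matrix ((Fin k × Fin k) × (Fin p × Fin q)) ((Fin k × Fin k) × (Fin p × Fin q)) ℂ) :
    twist U * A * (twist U)ᴴ * (twist U * B * (twist U)ᴴ) = twist U * (A * B) * (twist U)ᴴ := by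
  calc _ = twist U * A * ((twist U)ᴴ * twist U) * B * (twist U)ᴴ := by
        simp only [Matrix.mul_assoc]
    _ = _ := by
        rw [conjTranspose_twist_mul hU, Matrix.mul_one]
        simp only [Matrix.mul_assoc]

lemma keyProjector_mul_self (hk : k ≠ 0)
    (hU : ∀ x, U x ∈ Matrix.unitaryGroup (Fin p × Fin q) ℂ) :
    keyProjector U * keyProjector U = keyProjector U := by
  rw [keyProjector, Matrix.submatrix_mul_equiv, twisted_mul_twisted hU, ← Matrix.mul_kronecker_mul,
    maxEntangled_mul_self hk, Matrix.one_mul]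

/-- Both operators carry the same twist, which cancels and leaves the overlap of the maximally
entangled projector with itself times `tr σ`. -/
lemma trace_keyProjector_mul_private (hk : k ≠ 0)
    (hU : ∀ x, U x ∈ Matrix.unitaryGroup (Fin p × Fin q) ℂ)
    {σ : Matrix (Fin p × Fin q) (Fin p × Fin q) ℂ} (hσ : IsState σ) :
    (keyProjector U * (twist U * (maxEntangled k ⊗ₖ σ) * (twist U)ᴴ).submatrix
      (Equiv.prodProdProdComm _ _ _ _) (Equiv.prodProdProdComm _ _ _ _)).trace = 1 := by
  rw [keyProjector, Matrix.submatrix_mul_equiv, trace_submatrix_equiv, twisted_mul_twisted hU,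
    ← Matrix.mul_kronecker_mul, maxEntangled_mul_self hk, Matrix.one_mul, Matrix.trace_mul_comm,
    ← Matrix.mul_assoc, conjTranspose_twist_mul hU, Matrix.one_mul, Matrix.trace_kronecker,
    trace_maxEntangled hk, hσ.2, one_mul]

lemma sum_norm_sq_mulVec_of_unitary {ι : Type} [Fintype ι] [DecidableEq ι] {u : Matrix ι ι ℂ}
    (hu : uᴴ * u = 1) (v : ι → ℂ) : ∑ s, ‖(u *ᵥ v) s‖ ^ 2 = ∑ s, ‖v s‖ ^ 2 := by
  have h : ∀ w : ι → ℂ, star w ⬝ᵥ w = ((∑ s, ‖w s‖ ^ 2 : ℝ) : ℂ) := by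
    intro w
    rw [dotProduct, Complex.ofReal_sum]
    refine Finset.sum_congr rfl fun i _ => ?_
    rw [Pi.star_apply, mul_comm, ← starRingEnd_apply, Complex.mul_conj, Complex.normSq_eq_norm_sq]
  have h1 : star (u *ᵥ v) ⬝ᵥ (u *ᵥ v) = star v ⬝ᵥ v := by
    rw [Matrix.star_mulVec, ← Matrix.dotProduct_mulVec, Matrix.mulVec_mulVec, hu,
      Matrix.one_mulVec]
  rw [h, h] at h1
  exact_mod_cast h1

/-- The triangle inequality for vectors of norm `√(α i) √(β i)`, followed by Cauchy–Schwarz over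
`i`. -/
lemma sum_norm_sum_sq_le {ι κ : Type} [Fintype ι] [Fintype κ] (g : κ → ι → ℂ) (α β : κ → ℝ)
    (hg : ∀ i, ∑ s, ‖g i s‖ ^ 2 = α i * β i) (hα : ∀ i, 0 ≤ α i) (hβ : ∀ i, 0 ≤ β i) :
    ∑ s, ‖∑ i, g i s‖ ^ 2 ≤ (∑ i, α i) * ∑ i, β i := by
  have h1 : ∀ w : ι → ℂ, ‖WithLp.toLp 2 w‖ ^ 2 = ∑ s, ‖w s‖ ^ 2 := fun w => by
    rw [EuclideanSpace.norm_sq_eq]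
  have h2 : ∀ i, ‖WithLp.toLp 2 (g i)‖ = √(α i) * √(β i) := by
    intro i
    rw [← Real.sqrt_mul (hα i), ← hg, ← h1, Real.sqrt_sq (norm_nonneg _)]
  have h3 : ‖WithLp.toLp 2 (∑ i, g i)‖ ≤ ∑ i, √(α i) * √(β i) := by
    rw [WithLp.toLp_sum]
    exact (norm_sum_le _ _).trans_eq (Finset.sum_congr rfl fun i _ => h2 i)
  have h4 := h1 (∑ i, g i)
  simp only [Finset.sum_apply] at h4
  rw [← h4]
  refine (pow_le_pow_left₀ (norm_nonneg _) h3 2).trans ?_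
  refine (Finset.sum_mul_sq_le_sq_mul_sq _ _ _).trans_eq ?_
  simp only [Real.sq_sqrt (hα _), Real.sq_sqrt (hβ _)]

/-- After untwisting, the maximally entangled projector sees only the key blocks `(i, i)`. The
unitary `U (i, i)` preserves the norm of such a block, which is the product of the norms of the
`i`-th blocks of `y` and `z`; `sum_norm_sum_sq_le` then bounds their sum. -/
lemma dotProduct_keyProjector_le (hU : ∀ x, U x ∈ Matrix.unitaryGroup (Fin p × Fin q) ℂ)
    (y : Fin k × Fin p → ℂ) (z : Fin k × Fin q → ℂ) :
    star (fun x : (Fin k × Fin p) × (Fin k × Fin q) => y x.1 * z x.2) ⬝ᵥ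
      (keyProjector U *ᵥ fun x => y x.1 * z x.2) ≤
      (k : ℂ)⁻¹ * (((∑ i, ‖y i‖ ^ 2) * (∑ i, ‖z i‖ ^ 2) : ℝ) : ℂ) := by
  set w : (Fin k × Fin k) × (Fin p × Fin q) → ℂ :=
    fun x => y (x.1.1, x.2.1) * z (x.1.2, x.2.2) with hw
  set g : (Fin k × Fin k) × (Fin p × Fin q) → ℂ := (twist U)ᴴ *ᵥ w with hg
  have h1 : star (fun x : (Fin k × Fin p) × (Fin k × Fin q) => y x.1 * z x.2) ⬝ᵥ
      (keyProjector U *ᵥ fun x => y x.1 * z x.2) =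
      star g ⬝ᵥ ((maxEntangled k ⊗ₖ (1 : Matrix (Fin p × Fin q) (Fin p × Fin q) ℂ)) *ᵥ g) := by
    have e1 : (fun x : (Fin k × Fin p) × (Fin k × Fin q) => y x.1 * z x.2) =
        w ∘ Equiv.prodProdProdComm _ _ _ _ := rfl
    rw [e1, keyProjector, Matrix.submatrix_mulVec_equiv, Function.comp_assoc, Equiv.self_comp_symm,
      Function.comp_id]
    have e2 : ∀ u v : (Fin k × Fin k) × (Fin p × Fin q) → ℂ,
        star (u ∘ Equiv.prodProdProdComm (Fin k) (Fin p) (Fin k) (Fin q)) ⬝ᵥ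
          (v ∘ Equiv.prodProdProdComm (Fin k) (Fin p) (Fin k) (Fin q)) = star u ⬝ᵥ v :=
      fun u v => Equiv.sum_comp (Equiv.prodProdProdComm (Fin k) (Fin p) (Fin k) (Fin q))
        fun i => star u i * v i
    rw [e2, hg, Matrix.star_mulVec, Matrix.conjTranspose_conjTranspose, ← Matrix.dotProduct_mulVec,
      Matrix.mulVec_mulVec, Matrix.mulVec_mulVec, Matrix.mul_assoc]
  have h2 : star g ⬝ᵥ ((maxEntangled k ⊗ₖ (1 : Matrix (Fin p × Fin q) (Fin p × Fin q) ℂ)) *ᵥ g) =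
      (k : ℂ)⁻¹ * ((∑ s, ‖∑ i, g ((i, i), s)‖ ^ 2 : ℝ) : ℂ) := by
    have e1 : ∀ s, ((‖∑ i, g ((i, i), s)‖ ^ 2 : ℝ) : ℂ) =
        ∑ i, ∑ j, star (g ((i, i), s)) * g ((j, j), s) := by
      intro s
      rw [← Complex.normSq_eq_norm_sq, ← Complex.mul_conj, mul_comm, starRingEnd_apply, star_sum,
        Finset.sum_mul_sum]
    have e2 : ∀ x, ((maxEntangled k ⊗ₖ (1 : Matrix (Fin p × Fin q) (Fin p × Fin q) ℂ)) *ᵥ g) x =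
        if x.1.1 = x.1.2 then (k : ℂ)⁻¹ * ∑ j, g ((j, j), x.2) else 0 := by
      rintro ⟨⟨x₁, x₂⟩, s⟩
      rw [Matrix.mulVec, dotProduct, Fintype.sum_prod_type, Fintype.sum_prod_type]
      by_cases hx : x₁ = x₂
      · simp [maxEntangled, hx, Matrix.one_apply, Finset.mul_sum, ite_mul, mul_ite]
      · simp [maxEntangled, hx]
    rw [dotProduct, Complex.ofReal_sum]
    simp only [e1, e2, Pi.star_apply]
    rw [Fintype.sum_prod_type, Fintype.sum_prod_type, Finset.mul_sum]
    simp only [mul_ite, mul_zero]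
    rw [Finset.sum_congr rfl fun i _ => Finset.sum_comm]
    simp only [Finset.sum_ite_eq, Finset.mem_univ, if_true]
    rw [Finset.sum_comm]
    refine Finset.sum_congr rfl fun s _ => ?_
    simp only [Finset.mul_sum]
    refine Finset.sum_congr rfl fun i _ => Finset.sum_congr rfl fun j _ => ?_
    ring
  have h3 : ∀ i, ∑ s, ‖g ((i, i), s)‖ ^ 2 =
      (∑ t, ‖y (i, t)‖ ^ 2) * ∑ t, ‖z (i, t)‖ ^ 2 := by
    intro i
    have e1 : (fun s => g ((i, i), s)) =
        (U (i, i))ᴴ *ᵥ fun s : Fin p × Fin q => y (i, s.1) * z (i, s.2) := by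
      ext s
      rw [hg, Matrix.mulVec, dotProduct, Fintype.sum_prod_type, Finset.sum_eq_single (i, i)]
      · simp [twist, hw, Matrix.mulVec, dotProduct]
      · intro x _ hx
        simp [twist, hx]
      · simp
    have e2 : (U (i, i))ᴴᴴ * (U (i, i))ᴴ = 1 := by
      rw [Matrix.conjTranspose_conjTranspose]
      exact Matrix.mem_unitaryGroup_iff.1 (hU (i, i))
    have e3 := sum_norm_sq_mulVec_of_unitary e2 fun s : Fin p × Fin q => y (i, s.1) * z (i, s.2)
    rw [← e1] at e3
    rw [e3, Fintype.sum_prod_type, Finset.sum_mul_sum]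
    simp only [norm_mul, mul_pow]
  have h4 := sum_norm_sum_sq_le (fun i s => g ((i, i), s)) _ _ h3
    (fun i => by positivity) (fun i => by positivity)
  rw [h1, h2, Fintype.sum_prod_type (f := fun i => ‖y i‖ ^ 2),
    Fintype.sum_prod_type (f := fun i => ‖z i‖ ^ 2)]
  have hk : (0 : ℂ) ≤ (k : ℂ)⁻¹ := by
    rw [← Complex.ofReal_natCast, ← Complex.ofReal_inv]
    exact_mod_cast inv_nonneg.2 (Nat.cast_nonneg k)
  exact mul_le_mul_of_nonneg_left (by exact_mod_cast h4) hk

/-- Decompose both factors into rank one operators and use the bound for product vectors. -/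
lemma trace_keyProjector_mul_kronecker_le
    (hU : ∀ x, U x ∈ Matrix.unitaryGroup (Fin p × Fin q) ℂ)
    (Y : Matrix (Fin k × Fin p) (Fin k × Fin p) ℂ) (Z : Matrix (Fin k × Fin q) (Fin k × Fin q) ℂ)
    (hY : Y.PosSemidef) (hZ : Z.PosSemidef) :
    (keyProjector U * (Y ⊗ₖ Z)).trace ≤ (k : ℂ)⁻¹ * (Y.trace * Z.trace) := by
  obtain ⟨m, y, rfl⟩ := Matrix.posSemidef_iff_eq_sum_vecMulVec.1 hY
  obtain ⟨n, z, rfl⟩ := Matrix.posSemidef_iff_eq_sum_vecMulVec.1 hZ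
  have h1 : (∑ i, Matrix.vecMulVec (y i) (star (y i))) ⊗ₖ
      (∑ j, Matrix.vecMulVec (z j) (star (z j))) =
      ∑ i, ∑ j, Matrix.vecMulVec (fun x : (Fin k × Fin p) × (Fin k × Fin q) => y i x.1 * z j x.2)
        (star fun x : (Fin k × Fin p) × (Fin k × Fin q) => y i x.1 * z j x.2) := by
    ext u v
    simp only [Matrix.kroneckerMap_apply, Matrix.sum_apply, Matrix.vecMulVec_apply, Pi.star_apply,
      Finset.sum_mul_sum, star_mul']
    refine Finset.sum_congr rfl fun i _ => Finset.sum_congr rfl fun j _ => ?_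
    ring
  have htr : ∀ {κ : Type} [Fintype κ] (v : κ → ℂ),
      (Matrix.vecMulVec v (star v)).trace = ((∑ i, ‖v i‖ ^ 2 : ℝ) : ℂ) := by
    intro κ _ v
    rw [Matrix.trace_vecMulVec, dotProduct, Complex.ofReal_sum]
    refine Finset.sum_congr rfl fun i _ => ?_
    rw [Pi.star_apply, ← starRingEnd_apply, Complex.mul_conj, Complex.normSq_eq_norm_sq]
  rw [h1, Matrix.trace_sum, Matrix.trace_sum, Finset.sum_mul_sum, Finset.mul_sum, Finset.mul_sum,
    Matrix.trace_sum]
  refine Finset.sum_le_sum fun i _ => ?_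
  rw [Finset.mul_sum, Finset.mul_sum, Matrix.trace_sum]
  refine Finset.sum_le_sum fun j _ => ?_
  rw [Matrix.mul_vecMulVec, Matrix.trace_vecMulVec, dotProduct_comm, htr, htr, ← Complex.ofReal_mul]
  exact dotProduct_keyProjector_le hU (y i) (z j)

end PrivateStates

/-! ### Effects associated with positive functionals -/

section Effects

variable {ι : Type} [Fintype ι] [DecidableEq ι]

lemma posSemidef_of_forall_dotProduct_nonneg {M : Matrix ι ι ℂ}
    (h : ∀ v : ι → ℂ, 0 ≤ star v ⬝ᵥ (M *ᵥ v)) : M.PosSemidef := by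
  rw [← Matrix.isPositive_toEuclideanLin_iff, LinearMap.isPositive_iff_complex]
  intro v
  have h1 := h v.ofLp
  have h2 : inner ℂ (Matrix.toEuclideanLin M v) v = star (star v.ofLp ⬝ᵥ (M *ᵥ v.ofLp)) := by
    rw [← inner_conj_symm, starRingEnd_apply, EuclideanSpace.inner_eq_star_dotProduct,
      dotProduct_comm]
    rfl
  rw [h2]
  obtain ⟨hr, hi⟩ := Complex.le_def.1 h1
  refine ⟨?_, ?_⟩
  · apply Complex.ext <;> simp [← hi]
  · simpa using hr

/-- The trace pairing represents `φ` by a matrix `M`; testing `φ` on rank one projections shows that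
`M` and `1 - M` are positive. -/
lemma exists_effect (φ : Matrix ι ι ℂ →ₗ[ℂ] ℂ)
    (hφ : ∀ X : Matrix ι ι ℂ, X.PosSemidef → 0 ≤ φ X ∧ φ X ≤ X.trace) :
    ∃ M : Matrix ι ι ℂ, M.PosSemidef ∧ (1 - M).PosSemidef ∧ ∀ X, (X * M).trace = φ X := by
  set M : Matrix ι ι ℂ := Matrix.of fun i j => φ (Matrix.single j i 1) with hM
  have htr : ∀ X, (X * M).trace = φ X := by
    intro X
    conv_rhs => rw [Matrix.matrix_eq_sum_single X]
    simp only [map_sum, Matrix.trace, Matrix.diag_apply, Matrix.mul_apply]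
    refine Finset.sum_congr rfl fun i _ => Finset.sum_congr rfl fun j _ => ?_
    have : Matrix.single i j (X i j) = X i j • Matrix.single i j (1 : ℂ) := by
      rw [Matrix.smul_single, smul_eq_mul, mul_one]
    rw [this, map_smul, smul_eq_mul]
    rfl
  have hv : ∀ (N : Matrix ι ι ℂ) (v : ι → ℂ),
      star v ⬝ᵥ (N *ᵥ v) = (Matrix.vecMulVec v (star v) * N).trace := by
    intro N v
    rw [Matrix.trace_mul_comm, Matrix.mul_vecMulVec, Matrix.trace_vecMulVec, dotProduct_comm]
  refine ⟨M, ?_, ?_, htr⟩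
  · refine posSemidef_of_forall_dotProduct_nonneg fun v => ?_
    rw [hv, htr]
    exact (hφ _ (Matrix.posSemidef_vecMulVec_self_star v)).1
  · refine posSemidef_of_forall_dotProduct_nonneg fun v => ?_
    rw [hv, mul_sub, Matrix.trace_sub, Matrix.mul_one, htr, sub_nonneg]
    exact (hφ _ (Matrix.posSemidef_vecMulVec_self_star v)).2

end Effects

/-! ### The repeater input with an arbitrary state on Bob's side -/

section Repeater

variable {A CA CB B : Type}

/-- Charlie's and Alice's state `α`, together with the partial transpose of Charlie's and Bob's
state `τ`. -/
def embedBob {n : ℕ} (α : Matrix ((Fin n → CA) × (Fin n → A)) ((Fin n → CA) × (Fin n → A)) ℂ)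
    (τ : Matrix ((Fin n → CB) × (Fin n → B)) ((Fin n → CB) × (Fin n → B)) ℂ) :
    Matrix ((Fin n → A) × (Fin n → CA × CB) × (Fin n → B))
      ((Fin n → A) × (Fin n → CA × CB) × (Fin n → B)) ℂ :=
  (α ⊗ₖ partialTranspose τ).submatrix
    (fun x => ((fun i => (x.2.1 i).1, x.1), (fun i => (x.2.1 i).2, x.2.2)))
    (fun x => ((fun i => (x.2.1 i).1, x.1), (fun i => (x.2.1 i).2, x.2.2)))

/-- The transposition built into `embedBob` undoes the one in `ρ'^Γ`, so the actual input is the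
value at `(ρ'^Γ)^{⊗n}`. -/
lemma embedBob_bipartitePower (ρ : Matrix (CA × A) (CA × A) ℂ) (ρ' : Matrix (CB × B) (CB × B) ℂ)
    (n : ℕ) :
    embedBob (bipartitePower ρ n) (bipartitePower (partialTranspose ρ') n) =
      repeaterInput ρ ρ' n := by
  ext x y
  simp [embedBob, bipartitePower, partialTranspose, repeaterInput, tensorPower,
    Finset.prod_mul_distrib]

/-- Charlie's and Alice's state `α`, together with the transpose of a state `β` of Charlie. -/
def joinCharlie {n : ℕ} (α : Matrix ((Fin n → CA) × (Fin n → A)) ((Fin n → CA) × (Fin n → A)) ℂ)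
    (β : Matrix (Fin n → CB) (Fin n → CB) ℂ) :
    Matrix ((Fin n → A) × (Fin n → CA × CB)) ((Fin n → A) × (Fin n → CA × CB)) ℂ :=
  (α ⊗ₖ βᵀ).submatrix (fun x => ((fun i => (x.2 i).1, x.1), fun i => (x.2 i).2))
    (fun x => ((fun i => (x.2 i).1, x.1), fun i => (x.2 i).2))

variable {n : ℕ} (α : Matrix ((Fin n → CA) × (Fin n → A)) ((Fin n → CA) × (Fin n → A)) ℂ)

lemma embedBob_add (τ τ' : Matrix ((Fin n → CB) × (Fin n → B)) ((Fin n → CB) × (Fin n → B)) ℂ) :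
    embedBob α (τ + τ') = embedBob α τ + embedBob α τ' := by
  ext x y
  simp [embedBob, partialTranspose, mul_add]

lemma embedBob_smul (z : ℂ)
    (τ : Matrix ((Fin n → CB) × (Fin n → B)) ((Fin n → CB) × (Fin n → B)) ℂ) :
    embedBob α (z • τ) = z • embedBob α τ := by
  ext x y
  simp [embedBob, partialTranspose, mul_left_comm]

/-- Transposing all of Charlie's system cancels the transposition of `τ` and moves it to `α`, where
it is harmless by the PPT assumption. -/
lemma posSemidef_transposeCharlie_embedBob [Finite A] [Finite B] [Finite CA] [Finite CB]
    (hα : (partialTranspose α).PosSemidef)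
    {τ : Matrix ((Fin n → CB) × (Fin n → B)) ((Fin n → CB) × (Fin n → B)) ℂ}
    (hτ : τ.PosSemidef) : (transposeCharlie (embedBob α τ)).PosSemidef := by
  have := Fintype.ofFinite A
  have := Fintype.ofFinite B
  have := Fintype.ofFinite CA
  have := Fintype.ofFinite CB
  exact (hα.kronecker hτ).submatrix fun x : (Fin n → A) × (Fin n → CA × CB) × (Fin n → B) =>
    ((fun i => (x.2.1 i).1, x.1), (fun i => (x.2.1 i).2, x.2.2))

variable [Fintype A] [Fintype B] [Fintype CA] [Fintype CB]

lemma trace_partialTranspose {c a : Type} [Fintype c] [Fintype a] (X : Matrix (c × a) (c × a) ℂ) :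
    (partialTranspose X).trace = X.trace := rfl

lemma trace_embedBob (τ : Matrix ((Fin n → CB) × (Fin n → B)) ((Fin n → CB) × (Fin n → B)) ℂ) :
    (embedBob α τ).trace = α.trace * τ.trace := by
  rw [← trace_partialTranspose τ, ← Matrix.trace_kronecker]
  let e : (Fin n → A) × (Fin n → CA × CB) × (Fin n → B) ≃
      ((Fin n → CA) × (Fin n → A)) × ((Fin n → CB) × (Fin n → B)) :=
    { toFun := fun x => ((fun i => (x.2.1 i).1, x.1), (fun i => (x.2.1 i).2, x.2.2))
      invFun := fun y => (y.1.2, fun i => (y.1.1 i, y.2.1 i), y.2.2)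
      left_inv := fun _ => rfl
      right_inv := fun _ => rfl }
  exact trace_submatrix_equiv (α ⊗ₖ partialTranspose τ) e

/-- For a product state the transposition falls on Charlie's factor `β` alone, and `βᵀ` is again a
state. -/
lemma embedBob_kronecker (β : Matrix (Fin n → CB) (Fin n → CB) ℂ)
    (ζ : Matrix (Fin n → B) (Fin n → B) ℂ) :
    embedBob α (β ⊗ₖ ζ) = tensorBob (joinCharlie α β) ζ := by
  ext x y
  simp [embedBob, tensorBob, joinCharlie, partialTranspose, mul_assoc]

lemma trace_joinCharlie (β : Matrix (Fin n → CB) (Fin n → CB) ℂ) :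
    (joinCharlie α β).trace = α.trace * β.trace := by
  rw [← Matrix.trace_transpose β, ← Matrix.trace_kronecker]
  let e : (Fin n → A) × (Fin n → CA × CB) ≃ ((Fin n → CA) × (Fin n → A)) × (Fin n → CB) :=
    { toFun := fun x => ((fun i => (x.2 i).1, x.1), fun i => (x.2 i).2)
      invFun := fun y => (y.1.2, fun i => (y.1.1 i, y.2 i))
      left_inv := fun _ => rfl
      right_inv := fun _ => rfl }
  exact trace_submatrix_equiv (α ⊗ₖ βᵀ) e

end Repeater

/-! ### The bound on the key repeater rate -/

section Rate

variable {A CA CB B : Type} [Fintype A] [DecidableEq A] [Fintype CA] [DecidableEq CA]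
  [Fintype CB] [DecidableEq CB] [Fintype B] [DecidableEq B]

lemma isState_partialTranspose {ρ : Matrix (CA × A) (CA × A) ℂ} (h : IsState ρ)
    (h' : (partialTranspose ρ).PosSemidef) : IsState (partialTranspose ρ) :=
  ⟨h', by rw [trace_partialTranspose, h.2]⟩

/-- A protocol distilling `m` approximate key bits from `n` copies of PPT states bounds the relative
entropy of entanglement of the partially transposed input from below. -/
lemma achievable_le_relEntEntanglement {ρ : Matrix (CA × A) (CA × A) ℂ}
    {ρ' : Matrix (CB × B) (CB × B) ℂ} (hρ : IsState ρ) (hρ' : IsState ρ')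
    (hPPT : (partialTranspose ρ).PosSemidef) (hPPT' : (partialTranspose ρ').PosSemidef)
    {ε : ℝ} {n m : ℕ} (h : Achievable ρ ρ' ε n m) :
    (((1 - ε) * m - 1 / Real.log 2 : ℝ) : EReal) ≤
      relEntEntanglement (bipartitePower (partialTranspose ρ') n) := by
  obtain ⟨p, q, t, Λ, γ, hΛ, ⟨U, σ, hU, hσ, rfl⟩, hγ⟩ := h
  have hk : (2 ^ m : ℕ) ≠ 0 := pow_ne_zero m two_ne_zero
  set P := keyProjector U with hP
  have hPh : P.IsHermitian := isHermitian_keyProjector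
  have hPs : P * P = P := keyProjector_mul_self hk hU
  have hαs := isState_bipartitePower hρ n
  have hα : (partialTranspose (bipartitePower ρ n)).PosSemidef :=
    (isState_bipartitePower (isState_partialTranspose hρ hPPT) n).1
  let φ : Matrix ((Fin n → CB) × (Fin n → B)) ((Fin n → CB) × (Fin n → B)) ℂ →ₗ[ℂ] ℂ :=
    { toFun := fun τ => (traceCharlie (Λ (embedBob (bipartitePower ρ n) τ)) * P).trace
      map_add' := fun x y => by
        rw [embedBob_add, hΛ.map_add, traceCharlie_add, add_mul, Matrix.trace_add]
      map_smul' := fun z x => by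
        rw [embedBob_smul, hΛ.map_smul, traceCharlie_smul, Matrix.smul_mul, Matrix.trace_smul]
        rfl }
  have hφ : ∀ X : Matrix ((Fin n → CB) × (Fin n → B)) ((Fin n → CB) × (Fin n → B)) ℂ,
      X.PosSemidef → 0 ≤ φ X ∧ φ X ≤ X.trace := by
    intro X hX
    have h1 : (traceCharlie (Λ (embedBob (bipartitePower ρ n) X))).PosSemidef := by
      rw [← traceCharlie_transposeCharlie]
      exact posSemidef_traceCharlie (hΛ.posSemidef_transposeCharlie _
        (posSemidef_transposeCharlie_embedBob _ hα hX))
    refine ⟨trace_mul_nonneg h1 (posSemidef_of_projection hPh hPs), ?_⟩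
    have h2 := trace_mul_nonneg h1 (posSemidef_one_sub_of_projection hPh hPs)
    rw [mul_sub, Matrix.mul_one, Matrix.trace_sub, trace_traceCharlie, hΛ.trace_map,
      trace_embedBob, hαs.2, one_mul, sub_nonneg] at h2
    exact h2
  obtain ⟨M, hM, hM', hMφ⟩ := exists_effect φ hφ
  have hρ'n := isState_bipartitePower (isState_partialTranspose hρ' hPPT') n
  -- The private state has overlap one with `P`, and an `ε`-close output loses at most `ε`.
  have hp : 1 - ε ≤ (φ (bipartitePower (partialTranspose ρ') n)).re := by
    have h1 := (norm_trace_mul_le_traceNorm hPh hPs _).trans hγ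
    rw [mul_sub, Matrix.trace_sub, hP, trace_keyProjector_mul_private hk hU hσ, ← hP] at h1
    have h2 : φ (bipartitePower (partialTranspose ρ') n) =
        (P * traceCharlie (Λ (repeaterInput ρ ρ' n))).trace := by
      rw [← embedBob_bipartitePower, Matrix.trace_mul_comm]
      rfl
    rw [← h2] at h1
    have h3 := (Complex.abs_re_le_norm _).trans h1
    rw [Complex.sub_re, Complex.one_re] at h3
    linarith [(abs_le.1 h3).1]
  -- The bound is affine in `τ`, so it suffices to treat product states.
  have hq : ∀ τ ∈ separableStates (Fin n → CB) (Fin n → B), (φ τ).re ≤ ((2 : ℝ) ^ m)⁻¹ := by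
    intro τ hτ
    refine convexHull_min (t := {τ | (φ τ).re ≤ ((2 : ℝ) ^ m)⁻¹}) ?_ ?_ hτ
    · rintro _ ⟨β, ζ, hβ, hζ, rfl⟩
      have h1 := hΛ.trace_mul_tensorBob_le (trace_keyProjector_mul_kronecker_le hU)
        (joinCharlie (bipartitePower ρ n) β) ζ ((hαs.1.kronecker hβ.1.transpose).submatrix _) hζ.1
      rw [← embedBob_kronecker, trace_joinCharlie, hαs.2, hβ.2, hζ.2, Matrix.trace_mul_comm,
        mul_one, mul_one, mul_one] at h1
      have h2 := (Complex.le_def.1 h1).1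
      have h3 : (((2 ^ m : ℕ) : ℂ)⁻¹).re = ((2 : ℝ) ^ m)⁻¹ := by
        have : ((2 ^ m : ℕ) : ℂ)⁻¹ = ((((2 : ℝ) ^ m)⁻¹ : ℝ) : ℂ) := by push_cast; rfl
        rw [this, Complex.ofReal_re]
      rw [h3] at h2
      exact h2
    · intro x hx y hy s t hs ht hst
      have h1 : φ (s • x + t • y) = (s : ℂ) * φ x + (t : ℂ) * φ y := by
        have : s • x + t • y = (s : ℂ) • x + (t : ℂ) • y := by
          ext i j
          simp
        rw [this, map_add, map_smul, map_smul, smul_eq_mul, smul_eq_mul]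
      rw [Set.mem_ofPred_eq] at hx hy ⊢
      rw [h1, Complex.add_re, Complex.re_ofReal_mul, Complex.re_ofReal_mul]
      calc s * (φ x).re + t * (φ y).re ≤ s * ((2 : ℝ) ^ m)⁻¹ + t * ((2 : ℝ) ^ m)⁻¹ := by gcongr
        _ = _ := by rw [← add_mul, hst, one_mul]
  refine le_iInf₂ fun τ hτ => ?_
  have hpow : (1 : ℝ) ≤ 2 ^ m := one_le_pow₀ one_le_two
  refine le_trans ?_ (measured_le_relativeEntropy hρ'n (isState_of_mem_separableStates hτ) hM hM'
    hpow)
  rw [EReal.coe_le_coe_iff, hMφ, hMφ, Real.logb_pow, Real.logb_self_eq_one one_lt_two, mul_one]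
  have h1 : (1 - ε) * m ≤ (φ (bipartitePower (partialTranspose ρ') n)).re * m :=
    mul_le_mul_of_nonneg_right hp (Nat.cast_nonneg m)
  -- The choice `n = 2^m` in the variational bound gives `log₂ n = m`, while `2^{-m}(2^m - 1) ≤ 1`
  -- limits the loss to the constant `1 / ln 2`, independent of `m` and of the number of copies.
  have h2 : -1 ≤ (φ τ).re * (1 - 2 ^ m) := by
    have h3 := mul_le_mul_of_nonneg_right (hq τ hτ) (sub_nonneg.2 hpow)
    have h4 : ((2 : ℝ) ^ m)⁻¹ * (2 ^ m - 1) ≤ 1 := by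
      rw [mul_sub, inv_mul_cancel₀ (by positivity)]
      have : 0 ≤ ((2 : ℝ) ^ m)⁻¹ := by positivity
      linarith
    linarith
  have h3 : -1 / Real.log 2 ≤ (φ τ).re * (1 - 2 ^ m) / Real.log 2 :=
    div_le_div_of_nonneg_right h2 (Real.log_pos one_lt_two).le
  rw [neg_div] at h3
  linarith

/-- Per copy the constant `1 / ln 2` vanishes in the limit, leaving `L / (1 - ε)` for each `ε < 1`,
and `ε` is arbitrary. -/
lemma keyRepeaterRate_le {ρ : Matrix (CA × A) (CA × A) ℂ}
    {ρ' : Matrix (CB × B) (CB × B) ℂ} (hρ : IsState ρ) (hρ' : IsState ρ')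
    (hPPT : (partialTranspose ρ).PosSemidef) (hPPT' : (partialTranspose ρ').PosSemidef) :
    keyRepeaterRate ρ ρ' ≤ regRelEntEntanglement (partialTranspose ρ') := by
  have hs := isState_partialTranspose hρ' hPPT'
  obtain ⟨L, hL, hlim, -, hreg⟩ := exists_tendsto_relEntRate hs
  rw [hreg]
  set u : ℕ → ℝ := fun n =>
    (relEntEntanglement (bipartitePower (partialTranspose ρ') n)).toReal / n with hu
  have hε : ∀ ε : ℝ, 0 < ε → ε < 1 → keyRepeaterRate ρ ρ' ≤ ((L / (1 - ε) : ℝ) : EReal) := by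
    intro ε h0 h1
    refine (iInf₂_le ε h0).trans ?_
    have hlim2 : Tendsto (fun n : ℕ => (u n + 1 / Real.log 2 / n) / (1 - ε)) atTop
        (𝓝 (L / (1 - ε))) := by
      have := (hlim.add (tendsto_const_div_atTop_nhds_zero_nat (1 / Real.log 2))).div_const (1 - ε)
      rwa [add_zero] at this
    have hlim3 := (continuous_coe_real_ereal.tendsto _).comp hlim2
    rw [← hlim3.limsup_eq]
    refine limsup_le_limsup ?_
    filter_upwards [eventually_gt_atTop 0] with n hn
    refine iSup₂_le fun m hm => ?_
    have hle := achievable_le_relEntEntanglement hρ hρ' hPPT hPPT' hm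
    rw [← coe_toReal_relEntEntanglement (isState_bipartitePower hs n), EReal.coe_le_coe_iff] at hle
    rw [Function.comp_apply, EReal.coe_le_coe_iff, le_div_iff₀ (by linarith)]
    have hn' : (0 : ℝ) < n := Nat.cast_pos.2 hn
    rw [hu, ← add_div, div_mul_eq_mul_div]
    exact div_le_div_of_nonneg_right (by linarith) hn'.le
  -- The limit `ε → 0` is taken along `ε = 1 / (k + 2)`, which stays below one from `k = 0` on.
  have hlim4 : Tendsto (fun k : ℕ => ((L / (1 - 1 / ((k : ℝ) + 2)) : ℝ) : EReal)) atTop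
      (𝓝 (L : EReal)) := by
    refine (continuous_coe_real_ereal.tendsto _).comp ?_
    have h1 : Tendsto (fun k : ℕ => 1 / ((k : ℝ) + 2)) atTop (𝓝 0) :=
      tendsto_const_nhds.div_atTop (tendsto_atTop_add_const_right _ _ tendsto_natCast_atTop_atTop)
    have h2 := (tendsto_const_nhds (x := L)).div ((tendsto_const_nhds (x := (1 : ℝ))).sub h1)
      (by norm_num)
    rwa [sub_zero, div_one] at h2
  refine ge_of_tendsto' hlim4 fun k => hε _ (by positivity) ?_
  rw [div_lt_one (by positivity)]
  have : (0 : ℝ) ≤ k := Nat.cast_nonneg k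
  linarith

end Rate

end KeyRepeater

theorem mainTheorem6 {A CA CB B : Type}
    [Fintype A] [DecidableEq A] [Fintype CA] [DecidableEq CA]
    [Fintype CB] [DecidableEq CB] [Fintype B] [DecidableEq B]
    (ρ : Matrix (CA × A) (CA × A) ℂ) (ρ' : Matrix (CB × B) (CB × B) ℂ)
    (hρ : KeyRepeater.IsState ρ) (hρ' : KeyRepeater.IsState ρ')
    (hPPT : (KeyRepeater.partialTranspose ρ).PosSemidef)
    (hPPT' : (KeyRepeater.partialTranspose ρ').PosSemidef) :
    Tendsto (KeyRepeater.relEntRate (KeyRepeater.partialTranspose ρ)) atTop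
        (𝓝 (KeyRepeater.regRelEntEntanglement (KeyRepeater.partialTranspose ρ))) ∧
      Tendsto (KeyRepeater.relEntRate (KeyRepeater.partialTranspose ρ')) atTop
        (𝓝 (KeyRepeater.regRelEntEntanglement (KeyRepeater.partialTranspose ρ'))) ∧
      KeyRepeater.keyRepeaterRate ρ ρ' ≤
        KeyRepeater.regRelEntEntanglement (KeyRepeater.partialTranspose ρ) +
          KeyRepeater.regRelEntEntanglement (KeyRepeater.partialTranspose ρ') := by
  obtain ⟨L, hL, -, hlim, hreg⟩ := KeyRepeater.exists_tendsto_relEntRate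
    (KeyRepeater.isState_partialTranspose hρ hPPT)
  obtain ⟨L', -, -, hlim', hreg'⟩ := KeyRepeater.exists_tendsto_relEntRate
    (KeyRepeater.isState_partialTranspose hρ' hPPT')
  refine ⟨by rwa [hreg], by rwa [hreg'],
    (KeyRepeater.keyRepeaterRate_le hρ hρ' hPPT hPPT').trans ?_⟩
  -- The bound by the second term is already proved, and the first is a nonnegative limit.
  refine le_add_of_nonneg_left ?_
  rw [hreg]
  exact_mod_cast hL
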